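/- Let $E$ be a metric space with its Borel $\sigma$-algebra, and let $(X_t)_{t\ge 0}$ be a time-homogeneous Markov process with values in $E$, jointly measurable in time and randomness, with laws $(\mathbb P_x)_{x\in E}$ (measurable in $x$, $\mathbb P_x(X_0=x)=1$), and $\mathbb P_\mu=\int\mathbb P_x\,\mu(dx)$. Let $(A_t)_{t\ge0}$ be measurable subsets of $E$, $E_t=E\setminus A_t$, and $\tau_{A\circ\theta_s}=\inf\{t\ge0: X_t\in A_{t+s}\}$, $\tau_A=\tau_{A\circ\theta_0}$; these are assumed to be stopping times for a filtration with respect to which $X$ is Markov. Assume that $\mathbb P_x(\tau_{A\circ\theta_s}<\infty)=1$ and $\mathbb P_x(\tau_{A\circ\theta_s}>t)>0$ for all $s,t\ge0$ and $x\in E_s$. Assume that $A$ is $\gamma$-periodic for some $\gamma>0$, i.e. $A_{t+\gamma}=A_t$ for all $t\ge 0$, and that there are probability measures $\nu_s$ on $E_s$ ($s\ge0$), constants $c_1,c_2>0$ and a time $t_0=n_0\gamma>0$ with $n_0\in\mathbb N$ such that, for all $s,t\ge0$ and $x\in E_s$, $$\mathbb P_x(X_{t_0}\in\cdot\mid\tau_{A\circ\theta_s}>t_0)\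 \ge\ c_1\,\nu_{s+t_0},\qquad \mathbb P_{\nu_s}(\tau_{A\circ\theta_s}>t)\ \ge\ c_2\,\mathbb P_x(\tau_{A\circ\theta_s}>t).$$ Then there is a $Q$-process, that is, a family of probability measures $(\mathbb Q_{s,x})_{s\ge0,\,x\in E_s}$ on the space of paths $[0,\infty)\to E$ (with the product $\sigma$-algebra and coordinate process $X$) such that for all $s,t\ge0$ and $x\in E_s$ the law of the trajectory $X_{[0,t]}$ under $\mathbb P_x(\,\cdot\mid\tau_{A\circ\theta_s}>t+T)$ converges weakly, as $T\to\infty$, to the law of $X_{[s,s+t]}$ under $\mathbb Q_{s,x}$ (tested against bounded, measurable functionals that are continuous for pointwise convergence of paths). For every such family, writing $\mathbb Q_{0,\mu}=\int\mathbb Q_{0,x}\,\mu(dx)$, there is a unique probability measure $\beta_\gamma$ on $E_0$ with $$\beta_\gamma=\mathbb Q_{0,\beta_\gamma}(X_{n\gamma}\in\cdot)\quad\text{for all } n\in\mathbb N,$$ and for every $x\in E_0$, as $t\to\infty$, one has the weak convergence of measures on $E$ $$\frac1t\int_0^t\mathbb P_x(X_s\in\cdot\mid\tau_A>t)\,ds\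 \longrightarrow\ \frac1\gamma\int_0^\gamma\mathbb Q_{0,\beta_\gamma}(X_s\in\cdot)\,ds .$$ -/

import Mathlib

open MeasureTheory ProbabilityTheory Filter Topology
open scoped NNReal ENNReal BoundedContinuousFunction

/-- A time-homogeneous Markov process with time set `ℝ≥0` and state space `E`: a jointly measurable
process `X` on `Ω`, adapted to a filtration `𝓕` (for instance the natural one), with laws `P x`
started from `x`, depending measurably on `x`, and time shifts `θ t`, such that, given `𝓕 t`, the
future `θ t` has law `P (X t)`. -/
structure MarkovProcess (E Ω : Type*) [MeasurableSpace E] [mΩ : MeasurableSpace Ω] where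
  X : ℝ≥0 → Ω → E
  𝓕 : Filtration ℝ≥0 mΩ
  θ : ℝ≥0 → Ω → Ω
  P : Kernel E Ω
  isMarkovKernel : IsMarkovKernel P
  measurable_X : Measurable (Function.uncurry X)
  adapted : ∀ t, Measurable[𝓕 t] (X t)
  measurable_shift : ∀ t, Measurable (θ t)
  shift : ∀ s t ω, X s (θ t ω) = X (t + s) ω
  start : ∀ x, ∀ᵐ ω ∂(P x), X 0 ω = x
  markov : ∀ (x : E) (t : ℝ≥0) (C B : Set Ω), MeasurableSet[𝓕 t] C → MeasurableSet B →
    P x (C ∩ θ t ⁻¹' B) = ∫⁻ ω in C, P (X t ω) B ∂(P x)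

/-- Weak convergence of measures, tested against bounded continuous functions. Measurability of the
test function is automatic for a Borel σ-algebra; it is only a condition on path spaces. -/
def WeaklyTendsto {α ι : Type*} [TopologicalSpace α] [MeasurableSpace α]
    (l : Filter ι) (μ : ι → Measure α) (μ' : Measure α) : Prop :=
  ∀ f : α →ᵇ ℝ, Measurable f → Tendsto (fun i => ∫ a, f a ∂(μ i)) l (𝓝 (∫ a, f a ∂μ'))

/-- The measure `(1/t) ∫₀ᵗ m s ds`. -/
noncomputable def timeAverage {E : Type*} [MeasurableSpace E] (t : ℝ≥0) (m : ℝ≥0 → Measure E) :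
    Measure E :=
  (t : ℝ≥0∞)⁻¹ • (volume.restrict (Set.Ioc 0 (t : ℝ))).bind (fun s => m s.toNNReal)

namespace MarkovProcess

variable {E Ω : Type*} [MeasurableSpace E] [MeasurableSpace Ω]

/-- `τ_{A ∘ θ_s} = inf {t : X_t ∈ A_{t+s}}`, with value `∞` if there is no such `t`. -/
noncomputable def hitTime (M : MarkovProcess E Ω) (A : ℝ≥0 → Set E) (s : ℝ≥0) (ω : Ω) : ℝ≥0∞ :=
  ⨅ (t : ℝ≥0) (_ : M.X t ω ∈ A (t + s)), (t : ℝ≥0∞)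

/-- The event `{τ_{A ∘ θ_s} > t}`. -/
def survival (M : MarkovProcess E Ω) (A : ℝ≥0 → Set E) (s t : ℝ≥0) : Set Ω :=
  {ω | (t : ℝ≥0∞) < M.hitTime A s ω}

/-- The standing assumptions on the moving absorbing boundary `A`: each `A t` is measurable, the
`τ_{A ∘ θ_s}` are stopping times, almost surely finite, and larger than any `t` with positive
probability when started outside `A s`. -/
structure IsAbsorbingBoundary (M : MarkovProcess E Ω) (A : ℝ≥0 → Set E) : Prop where
  measurableSet : ∀ t, MeasurableSet (A t)
  stopping : ∀ s t, MeasurableSet[M.𝓕 t] (M.survival A s t)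
  finite : ∀ s, ∀ x ∉ A s, M.P x {ω | M.hitTime A s ω < ∞} = 1
  pos : ∀ s t, ∀ x ∉ A s, 0 < M.P x (M.survival A s t)

/-- The conditions of Champagnat–Villemonais type, with the time `t₀`. -/
def ConditionCV (M : MarkovProcess E Ω) (A : ℝ≥0 → Set E) (t₀ : ℝ≥0) : Prop :=
  0 < t₀ ∧ ∃ (ν : ℝ≥0 → Measure E) (c₁ c₂ : ℝ≥0), 0 < c₁ ∧ 0 < c₂ ∧
    (∀ s, IsProbabilityMeasure (ν s) ∧ ν s (A s) = 0) ∧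
    (∀ s, ∀ x ∉ A s,
      c₁ • ν (s + t₀) ≤ ((M.P x)[|M.survival A s t₀]).map (M.X t₀)) ∧
    (∀ s t, ∀ x ∉ A s,
      (c₂ : ℝ≥0∞) * M.P x (M.survival A s t) ≤ ((ν s).bind M.P) (M.survival A s t))

/-- `Q s x`, for `x ∉ A s`, is a probability measure on the paths `ℝ≥0 → E`, and for every `t` the
law of the trajectory `X_{[0,t]}` under `P x` given `τ_{A ∘ θ_s} > t + T` converges weakly, as
`T → ∞`, to the law of the trajectory between times `s` and `s + t` under `Q s x`. -/
def IsQProcessFamily [TopologicalSpace E] (M : MarkovProcess E Ω) (A : ℝ≥0 → Set E)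
    (Q : ℝ≥0 → E → Measure (ℝ≥0 → E)) : Prop :=
  ∀ s, ∀ x ∉ A s, IsProbabilityMeasure (Q s x) ∧
    ∀ t : ℝ≥0, WeaklyTendsto atTop
      (fun T : ℝ≥0 => ((M.P x)[|M.survival A s (t + T)]).map
        (fun ω (u : Set.Icc (0 : ℝ≥0) t) => M.X u ω))
      ((Q s x).map (fun w (u : Set.Icc (0 : ℝ≥0) t) => w (s + u)))

end MarkovProcess

/-- `β` is a probability measure on the complement of `A₀`, and it is the law of every `X_{nγ}`
under `Q_{0,β} = ∫ Q_{0,x} β(dx)`. -/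
def IsInvariantSkeleton {E : Type*} [MeasurableSpace E] (A₀ : Set E)
    (Q : ℝ≥0 → E → Measure (ℝ≥0 → E)) (γ : ℝ≥0) (β : Measure E) : Prop :=
  IsProbabilityMeasure β ∧ β A₀ = 0 ∧ ∀ n : ℕ, β = (β.bind (Q 0)).map (fun w => w (n * γ))

/-! ### Survival events and the Markov property -/

namespace MarkovProcess

variable {E Ω : Type*} [MeasurableSpace E] [MeasurableSpace Ω] {M : MarkovProcess E Ω}
  {A : ℝ≥0 → Set E}

/-! The engine is Doeblin's argument for the process conditioned to survive up to a distant horizon.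
Over a step of length `t₀`, the conditioned laws started at different points share a part of mass
`c₁ * c₂`: `c₁` comes from the minorization, and `c₂` controls the reweighting by later survival.
Iterating (`convexComb_le`, `exists_minorant`) gives a common minorant of mass at least `1 - (1 - c₁
* c₂) ^ k` after time `k * t₀`, uniformly in the horizon.

Forgetting the starting point makes the survival probabilities of different points asymptotically
proportional (`ratio_le_add`). The limiting ratio `η_s` (`limitRatio`) is positive and finite off `A
s`, and it is an eigenfunction up to a constant: `E_x[η_{s+a}(X_a); τ > a] = l η_s(x)`, with `l`
independent of `x` (`exists_limitMass_eq`). Its Doob transform is a Markov family `κ`, and on `𝓕 a`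
the law of the process conditioned to survive past `a + U` is at most `r * κ s a x` once `U` is
large, uniformly in `s`, `a`, `x` (`exists_cond_le`). As both are probability measures, this
one-sided domination gives convergence in total variation, which is stronger than the weak
convergence asked of a Q-process. Kolmogorov extension needs regularity of `E`, so the path law is
built by Ionescu-Tulcea, from a chain of trajectories of unit length. Any Q-process family agrees
with this one at starting time `0`.

Periodicity of `A` turns the transitions of `κ` over multiples of `γ` into a semigroup that inherits
the minorants, hence has exactly one invariant law `β` off `A 0`. For `u` and `t - u` both large,
the law of `X_u` given survival past `t` is close to that of `X_u` under the Q-process started from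
`β` (`exists_integral_cond_close`). The latter is `γ`-periodic in `u`, and the two excluded ends of
`[0, t]` do not count in a time average. -/

instance (M : MarkovProcess E Ω) : IsMarkovKernel M.P := M.isMarkovKernel

lemma measurable_coord (M : MarkovProcess E Ω) (t : ℝ≥0) : Measurable (M.X t) :=
  M.measurable_X.comp measurable_prodMk_left

lemma lt_hitTime_iff {s t : ℝ≥0} {ω : Ω} :
    (t : ℝ≥0∞) < M.hitTime A s ω ↔ ∃ c : ℝ≥0, t < c ∧ ∀ r : ℝ≥0, M.X r ω ∈ A (r + s) → c ≤ r := by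
  constructor
  · intro h
    obtain ⟨c, hc, hc'⟩ := ENNReal.lt_iff_exists_nnreal_btwn.1 h
    refine ⟨c, by exact_mod_cast hc, fun r hr => ?_⟩
    have : M.hitTime A s ω ≤ r := iInf₂_le r hr
    exact_mod_cast hc'.le.trans this
  · rintro ⟨c, hc, h⟩
    refine lt_of_lt_of_le (b := (c : ℝ≥0∞)) (by exact_mod_cast hc) ?_
    exact le_iInf₂ fun r hr => by exact_mod_cast h r hr

/-- This splitting lets the Markov property act on survival: after time `t` the shifted path faces
the boundary started at `s + t`. -/
lemma survival_add (M : MarkovProcess E Ω) (A : ℝ≥0 → Set E) (s t u : ℝ≥0) :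
    M.survival A s (t + u) = M.survival A s t ∩ M.θ t ⁻¹' M.survival A (s + t) u := by
  ext ω
  simp only [survival, Set.mem_inter_iff, Set.mem_preimage, Set.mem_ofPred_eq, lt_hitTime_iff,
    M.shift]
  constructor
  · rintro ⟨c, hc, h⟩
    refine ⟨⟨c, lt_of_le_of_lt le_self_add hc, h⟩, c - t, lt_tsub_iff_left.2 hc, fun r hr => ?_⟩
    exact tsub_le_iff_left.2 (h (t + r) (by convert hr using 2; ring))
  · rintro ⟨⟨c, hc, h⟩, d, hd, h'⟩
    refine ⟨t + d, by gcongr, fun r hr => ?_⟩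
    -- A hit before `c` is excluded by the first event; since `t < c`, a later one is a hit of the
    -- shifted path.
    obtain hrt | hrt := lt_or_ge r c
    · exact absurd (h r hr) (not_le.2 hrt)
    · obtain ⟨v, rfl⟩ := exists_add_of_le (hc.le.trans hrt)
      gcongr
      exact h' v (by convert hr using 2; ring)

lemma coord_notMem_of_mem_survival {s t : ℝ≥0} {ω : Ω} (h : ω ∈ M.survival A s t) :
    M.X t ω ∉ A (s + t) := by
  obtain ⟨c, hc, h⟩ := lt_hitTime_iff.1 h
  exact fun ht => absurd (h t (by rwa [add_comm])) (not_le.2 hc)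

lemma survival_congr {s s' : ℝ≥0} (h : ∀ t, A (t + s) = A (t + s')) :
    M.survival A s = M.survival A s' := by
  funext t; ext ω
  simp only [survival, Set.mem_ofPred_eq, lt_hitTime_iff, h]

lemma IsAbsorbingBoundary.measurableSet_survival (hA : M.IsAbsorbingBoundary A) (s t : ℝ≥0) :
    MeasurableSet (M.survival A s t) :=
  M.𝓕.le t _ (hA.stopping s t)

lemma setLIntegral_shift (M : MarkovProcess E Ω) (x : E) {t : ℝ≥0} {C : Set Ω}
    (hC : MeasurableSet[M.𝓕 t] C) {f : Ω → ℝ≥0∞} (hf : Measurable f) :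
    ∫⁻ ω in C, f (M.θ t ω) ∂(M.P x) = ∫⁻ ω in C, (∫⁻ ω', f ω' ∂(M.P (M.X t ω))) ∂(M.P x) := by
  have hP : Measurable fun ω => M.P (M.X t ω) := M.P.measurable.comp (M.measurable_coord t)
  have key : ((M.P x).restrict C).map (M.θ t) =
      ((M.P x).restrict C).bind fun ω => M.P (M.X t ω) := by
    ext B hB
    rw [Measure.map_apply (M.measurable_shift t) hB, Measure.bind_apply hB hP.aemeasurable,
      Measure.restrict_apply (M.measurable_shift t hB), Set.inter_comm, M.markov x t C B hC hB]
  rw [← lintegral_map hf (M.measurable_shift t), key,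
    Measure.lintegral_bind hP.aemeasurable hf.aemeasurable]

lemma setLIntegral_survival_add (hA : M.IsAbsorbingBoundary A) (x : E) (s t u : ℝ≥0) {C : Set Ω}
    (hC : MeasurableSet[M.𝓕 t] C) {f : Ω → ℝ≥0∞} (hf : Measurable f) :
    ∫⁻ ω in C ∩ M.survival A s (t + u), f (M.θ t ω) ∂(M.P x) =
      ∫⁻ ω in C ∩ M.survival A s t,
        (∫⁻ ω' in M.survival A (s + t) u, f ω' ∂(M.P (M.X t ω))) ∂(M.P x) := by
  have hS := hA.measurableSet_survival (s + t) u
  have hS' : MeasurableSet[M.𝓕 t] (C ∩ M.survival A s t) := hC.inter (hA.stopping s t)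
  simp_rw [← lintegral_indicator hS]
  rw [← M.setLIntegral_shift x hS' (hf.indicator hS), survival_add, ← Set.inter_assoc,
    Set.inter_comm (C ∩ _), ← Measure.restrict_restrict (M.measurable_shift t hS),
    ← lintegral_indicator (M.measurable_shift t hS)]
  rfl

lemma measure_survival_add_inter (hA : M.IsAbsorbingBoundary A) (x : E) (s t u : ℝ≥0) {C B : Set Ω}
    (hC : MeasurableSet[M.𝓕 t] C) (hB : MeasurableSet B) :
    M.P x (C ∩ M.survival A s (t + u) ∩ M.θ t ⁻¹' B) =
      ∫⁻ ω in C ∩ M.survival A s t, M.P (M.X t ω) (M.survival A (s + t) u ∩ B) ∂(M.P x) := by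
  rw [← M.markov x t _ _ (hC.inter (hA.stopping s t))
    ((hA.measurableSet_survival (s + t) u).inter hB), survival_add, Set.preimage_inter]
  congr 1
  tauto_set

lemma measure_survival_add (hA : M.IsAbsorbingBoundary A) (x : E) (s t u : ℝ≥0) {C : Set Ω}
    (hC : MeasurableSet[M.𝓕 t] C) :
    M.P x (C ∩ M.survival A s (t + u)) =
      ∫⁻ ω in C ∩ M.survival A s t, M.P (M.X t ω) (M.survival A (s + t) u) ∂(M.P x) := by
  simpa using measure_survival_add_inter hA x s t u hC MeasurableSet.univ

/-! ### The minorization conditions in unnormalised form -/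

/-- Conditions of Champagnat–Villemonais type, with explicit constants at most one, written without
conditional probabilities. -/
structure Minorization (M : MarkovProcess E Ω) (A : ℝ≥0 → Set E) (t₀ : ℝ≥0) (ν : ℝ≥0 → Measure E)
    (c₁ c₂ : ℝ≥0∞) : Prop where
  boundary : M.IsAbsorbingBoundary A
  c₁_pos : 0 < c₁
  c₂_pos : 0 < c₂
  c₁_le : c₁ ≤ 1
  c₂_le : c₂ ≤ 1
  time_pos : 0 < t₀
  isProbabilityMeasure : ∀ s, IsProbabilityMeasure (ν s)
  null : ∀ s, ν s (A s) = 0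
  lower : ∀ s, ∀ x ∉ A s, (c₁ * M.P x (M.survival A s t₀)) • ν (s + t₀) ≤
    ((M.P x).restrict (M.survival A s t₀)).map (M.X t₀)
  upper : ∀ s t, ∀ x ∉ A s, c₂ * M.P x (M.survival A s t) ≤ ∫⁻ y, M.P y (M.survival A s t) ∂(ν s)

lemma ConditionCV.exists_minorization (hA : M.IsAbsorbingBoundary A) {t₀ : ℝ≥0}
    (h : M.ConditionCV A t₀) : ∃ ν c₁ c₂, M.Minorization A t₀ ν c₁ c₂ := by
  obtain ⟨h0, ν, c₁, c₂, h1, h2, hν, hl, hu⟩ := h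
  -- Truncation at one makes `1 - c₁ * c₂` a genuine difference in `ℝ≥0∞`.
  refine ⟨ν, min c₁ 1, min c₂ 1, hA, by simpa using h1, by simpa using h2, min_le_right _ _,
    min_le_right _ _, h0, fun s => (hν s).1, fun s => (hν s).2, fun s x hx => ?_,
    fun s t x hx => ?_⟩
  · refine Measure.le_iff.2 fun B hB => ?_
    have h := hl s x hx B
    have hm := M.measurable_coord t₀
    rw [Measure.map_apply hm hB] at h ⊢
    have hp := hA.pos s t₀ x hx
    rw [cond_apply (hA.measurableSet_survival s t₀)] at h
    rw [Measure.restrict_apply (hm hB), Set.inter_comm]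
    rw [mul_comm (_)⁻¹, ← div_eq_mul_inv,
      ENNReal.le_div_iff_mul_le (Or.inl hp.ne') (Or.inl (measure_ne_top _ _))] at h
    refine le_trans ?_ h
    simp only [Measure.smul_apply, smul_eq_mul, Measure.nnreal_smul_coe_apply]
    rw [mul_right_comm]
    gcongr
    exact min_le_left (c₁ : ℝ≥0∞) 1
  · have h := hu s t x hx
    rw [Measure.bind_apply (hA.measurableSet_survival s t) M.P.measurable.aemeasurable] at h
    refine le_trans ?_ h
    gcongr
    exact min_le_left (c₂ : ℝ≥0∞) 1

namespace Minorization

variable {t₀ : ℝ≥0} {ν : ℝ≥0 → Measure E} {c₁ c₂ : ℝ≥0∞}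

lemma const_ne_zero (h : M.Minorization A t₀ ν c₁ c₂) : c₁ * c₂ ≠ 0 :=
  mul_ne_zero h.c₁_pos.ne' h.c₂_pos.ne'

lemma const_le (h : M.Minorization A t₀ ν c₁ c₂) : c₁ * c₂ ≤ 1 :=
  mul_le_one' h.c₁_le h.c₂_le

lemma ae_notMem (h : M.Minorization A t₀ ν c₁ c₂) (s : ℝ≥0) : ∀ᵐ y ∂(ν s), y ∉ A s :=
  measure_eq_zero_iff_ae_notMem.1 (h.null s)

lemma measurable_survival (h : M.Minorization A t₀ ν c₁ c₂) (s t : ℝ≥0) :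
    Measurable fun y => M.P y (M.survival A s t) :=
  M.P.measurable_coe (h.boundary.measurableSet_survival s t)

lemma lintegral_pos (h : M.Minorization A t₀ ν c₁ c₂) (s t : ℝ≥0) :
    ∫⁻ y, M.P y (M.survival A s t) ∂(ν s) ≠ 0 := by
  have := h.isProbabilityMeasure s
  intro h0
  rw [lintegral_eq_zero_iff (h.measurable_survival s t)] at h0
  obtain ⟨y, hy, hy'⟩ := (h0.and (h.ae_notMem s)).exists
  exact (h.boundary.pos s t y hy').ne' hy

lemma lintegral_le_one (h : M.Minorization A t₀ ν c₁ c₂) (s t : ℝ≥0) :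
    ∫⁻ y, M.P y (M.survival A s t) ∂(ν s) ≤ 1 := by
  have := h.isProbabilityMeasure s
  calc _ ≤ ∫⁻ _, 1 ∂(ν s) := lintegral_mono fun _ => prob_le_one
    _ = 1 := by simp

lemma lower_lintegral (h : M.Minorization A t₀ ν c₁ c₂) {s : ℝ≥0} {x : E} (hx : x ∉ A s)
    {g : E → ℝ≥0∞} (hg : Measurable g) :
    c₁ * M.P x (M.survival A s t₀) * ∫⁻ y, g y ∂(ν (s + t₀)) ≤
      ∫⁻ ω in M.survival A s t₀, g (M.X t₀ ω) ∂(M.P x) := by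
  have := lintegral_mono' (h.lower s x hx) (le_refl g)
  rwa [lintegral_smul_measure, lintegral_map hg (M.measurable_coord t₀)] at this

/-- The Markov property at time `U - t₀` reduces this to the minorization over the last stretch of
length `t₀`. -/
lemma lower_lintegral_of_le (h : M.Minorization A t₀ ν c₁ c₂) {s U : ℝ≥0} (hU : t₀ ≤ U) (x : E)
    {g : E → ℝ≥0∞} (hg : Measurable g) :
    c₁ * M.P x (M.survival A s U) * ∫⁻ y, g y ∂(ν (s + U)) ≤
      ∫⁻ ω in M.survival A s U, g (M.X U ω) ∂(M.P x) := by
  obtain ⟨t, rfl⟩ := exists_add_of_le hU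
  rw [add_comm t₀ t]
  have hm := h.boundary.measurableSet_survival
  have e1 := setLIntegral_survival_add h.boundary x s t t₀ MeasurableSet.univ
    (hg.comp (M.measurable_coord t₀))
  have e2 := measure_survival_add h.boundary x s t t₀ MeasurableSet.univ
  simp only [Set.univ_inter, Function.comp_apply, M.shift] at e1 e2
  rw [e1, e2, ← lintegral_const_mul' _ _ (ne_top_of_le_ne_top ENNReal.one_ne_top h.c₁_le),
    ← lintegral_mul_const'']
  · refine setLIntegral_mono' (hm s t) fun ω hω => ?_
    rw [← add_assoc]
    exact h.lower_lintegral (coord_notMem_of_mem_survival hω) hg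
  · exact (((h.measurable_survival _ _).comp (M.measurable_coord t)).const_mul _).aemeasurable

/-- After time `U`, no position survives better than `ν (s + U)` by more than a factor `c₂⁻¹`. -/
lemma upper_lintegral (h : M.Minorization A t₀ ν c₁ c₂) {s U V : ℝ≥0} (x : E) :
    c₂ * M.P x (M.survival A s (U + V)) ≤
      M.P x (M.survival A s U) * ∫⁻ y, M.P y (M.survival A (s + U) V) ∂(ν (s + U)) := by
  have e2 := measure_survival_add h.boundary x s U V MeasurableSet.univ
  simp only [Set.univ_inter] at e2
  rw [e2, ← lintegral_const_mul' _ _ (ne_top_of_le_ne_top ENNReal.one_ne_top h.c₂_le)]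
  calc _ ≤ ∫⁻ ω in M.survival A s U,
        (∫⁻ y, M.P y (M.survival A (s + U) V) ∂(ν (s + U))) ∂(M.P x) :=
        setLIntegral_mono' (h.boundary.measurableSet_survival s U) fun ω hω =>
          h.upper _ _ _ (coord_notMem_of_mem_survival hω)
    _ = _ := by rw [setLIntegral_const, mul_comm]

end Minorization

end MarkovProcess
-- Contraction of the laws conditioned on survival
namespace MarkovProcess.Minorization

variable {E Ω : Type*} [MeasurableSpace E] [MeasurableSpace Ω] {M : MarkovProcess E Ω}
  {A : ℝ≥0 → Set E} {t₀ : ℝ≥0} {ν : ℝ≥0 → Measure E} {c₁ c₂ : ℝ≥0∞}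

/-- One step of the contraction: a lower bound `a` for the conditional probabilities of an event
improves to a convex combination of `a` and a probability under the conditioned minorant. -/
lemma convexComb_le (h : M.Minorization A t₀ ν c₁ c₂) {s V : ℝ≥0} {x : E} (hx : x ∉ A s)
    {G : E → ℝ≥0∞} (hG : Measurable G) {a : ℝ≥0∞}
    (haG : ∀ y ∉ A (s + t₀), a * M.P y (M.survival A (s + t₀) V) ≤ G y) :
    ((1 - c₁ * c₂) * a + c₁ * c₂ * ((∫⁻ y, M.P y (M.survival A (s + t₀) V) ∂(ν (s + t₀)))⁻¹ *
      ∫⁻ y, G y ∂(ν (s + t₀)))) * M.P x (M.survival A s (t₀ + V)) ≤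
      ∫⁻ ω in M.survival A s t₀, G (M.X t₀ ω) ∂(M.P x) := by
  set H : E → ℝ≥0∞ := fun y => M.P y (M.survival A (s + t₀) V) with hH
  have hHm : Measurable H := h.measurable_survival _ _
  set N := ∫⁻ y, H y ∂(ν (s + t₀)) with hN
  have hN0 : N ≠ 0 := h.lintegral_pos _ _
  have hNt : N ≠ ∞ := ne_top_of_le_ne_top ENNReal.one_ne_top (h.lintegral_le_one _ _)
  have hS := h.boundary.measurableSet_survival s t₀
  set F := M.P x (M.survival A s (t₀ + V)) with hF
  set p := M.P x (M.survival A s t₀) with hp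
  -- Only the excess of `G` over its guaranteed part `a * H` can improve the bound. Off `A (s + t₀)`
  -- the truncated subtraction is exact by `haG`.
  set W := ∫⁻ y, (G y - a * H y) ∂(ν (s + t₀)) with hW
  have hmeas : Measurable fun y => G y - a * H y := hG.sub (hHm.const_mul a)
  have e1 : ∫⁻ y, G y ∂(ν (s + t₀)) = a * N + W := by
    rw [hN, ← lintegral_const_mul _ hHm, hW, ← lintegral_add_right _ hmeas]
    refine lintegral_congr_ae ?_
    filter_upwards [h.ae_notMem (s + t₀)] with y hy
    exact (add_tsub_cancel_of_le (haG y hy)).symm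
  have e2 : ∫⁻ ω in M.survival A s t₀, G (M.X t₀ ω) ∂(M.P x) =
      a * F + ∫⁻ ω in M.survival A s t₀, (G (M.X t₀ ω) - a * H (M.X t₀ ω)) ∂(M.P x) := by
    have := measure_survival_add h.boundary x s t₀ V MeasurableSet.univ
    simp only [Set.univ_inter] at this
    have hm1 : Measurable fun ω => H (M.X t₀ ω) := hHm.comp (M.measurable_coord t₀)
    have hm2 : Measurable fun ω => G (M.X t₀ ω) - a * H (M.X t₀ ω) :=
      hmeas.comp (M.measurable_coord t₀)
    change F = ∫⁻ ω in M.survival A s t₀, H (M.X t₀ ω) ∂(M.P x) at this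
    rw [this, ← lintegral_const_mul _ hm1, ← lintegral_add_right _ hm2]
    refine setLIntegral_congr_fun hS fun ω hω => ?_
    exact (add_tsub_cancel_of_le (haG _ (coord_notMem_of_mem_survival hω))).symm
  have e3 : c₁ * p * W ≤
      ∫⁻ ω in M.survival A s t₀, (G (M.X t₀ ω) - a * H (M.X t₀ ω)) ∂(M.P x) :=
    h.lower_lintegral hx hmeas
  have e4 : c₂ * F ≤ p * N := h.upper_lintegral x
  -- `e4` trades survival up to `t₀`, where the minorization holds, for survival up to `t₀ + V`;
  -- this costs the factor `c₂`.
  have e5 : c₁ * c₂ * (N⁻¹ * W) * F ≤ c₁ * p * W := by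
    calc c₁ * c₂ * (N⁻¹ * W) * F = c₁ * W * N⁻¹ * (c₂ * F) := by ring
      _ ≤ c₁ * W * N⁻¹ * (p * N) := by gcongr
      _ = c₁ * p * W * (N⁻¹ * N) := by ring
      _ = _ := by rw [ENNReal.inv_mul_cancel hN0 hNt, mul_one]
  rw [e1, e2, mul_add N⁻¹, mul_left_comm N⁻¹ a, ENNReal.inv_mul_cancel hN0 hNt, mul_one]
  calc _ = ((1 - c₁ * c₂) + c₁ * c₂) * a * F + c₁ * c₂ * (N⁻¹ * W) * F := by ring
    _ = a * F + c₁ * c₂ * (N⁻¹ * W) * F := by rw [tsub_add_cancel_of_le h.const_le, one_mul]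
    _ ≤ _ := by gcongr; exact e5.trans e3

/-- Doeblin's iteration. The measure `m` may depend on the horizon `V`, but its mass deficit does
not. -/
lemma exists_minorant (h : M.Minorization A t₀ ν c₁ c₂) (k : ℕ) (s t V : ℝ≥0) (hk : k * t₀ ≤ t) :
    ∃ m : Measure E, 1 ≤ m Set.univ + (1 - c₁ * c₂) ^ k ∧
      ∀ x ∉ A s, M.P x (M.survival A s (t + V)) • m ≤
        ((M.P x).restrict (M.survival A s (t + V))).map (M.X t) := by
  induction k generalizing s t with
  | zero => exact ⟨0, by simp, fun x _ => by
      rw [smul_zero]; exact Measure.zero_le _⟩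
  | succ k ih =>
    obtain ⟨u, rfl⟩ := exists_add_of_le (show t₀ ≤ t from le_trans (by
      push_cast; rw [add_mul, one_mul]; exact le_add_self) hk)
    have hk' : k * t₀ ≤ u := by
      push_cast at hk; rw [add_mul, one_mul, add_comm] at hk; exact le_of_add_le_add_left hk
    obtain ⟨m, hm, hmx⟩ := ih (s + t₀) u hk'
    have := h.isProbabilityMeasure (s + t₀)
    set S := M.survival A (s + t₀) (u + V) with hS
    have hSm : MeasurableSet S := h.boundary.measurableSet_survival _ _
    set N := ∫⁻ y, M.P y S ∂(ν (s + t₀)) with hN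
    have hN0 : N ≠ 0 := h.lintegral_pos _ _
    have hNt : N ≠ ∞ := ne_top_of_le_ne_top ENNReal.one_ne_top (h.lintegral_le_one _ _)
    have hb : ((ν (s + t₀)).bind M.P) S = N := Measure.bind_apply hSm M.P.measurable.aemeasurable
    -- The new part is the law of `X u` started from `ν (s + t₀)` and conditioned on `S`, a
    -- probability measure; hence the deficit is multiplied by `1 - c₁ * c₂`.
    refine ⟨(1 - c₁ * c₂) • m +
      (c₁ * c₂) • N⁻¹ • (((ν (s + t₀)).bind M.P).restrict S).map (M.X u), ?_, fun x hx => ?_⟩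
    · simp only [Measure.add_apply, Measure.smul_apply, smul_eq_mul,
        Measure.map_apply (M.measurable_coord u) MeasurableSet.univ, Set.preimage_univ,
        Measure.restrict_apply_univ, hb, ENNReal.inv_mul_cancel hN0 hNt, mul_one]
      calc (1 : ℝ≥0∞) = (1 - c₁ * c₂) * 1 + c₁ * c₂ := by
            rw [mul_one, tsub_add_cancel_of_le h.const_le]
        _ ≤ (1 - c₁ * c₂) * (m Set.univ + (1 - c₁ * c₂) ^ k) + c₁ * c₂ := by gcongr
        _ = _ := by ring
    · refine Measure.le_iff.2 fun B hB => ?_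
      have hBm := M.measurable_coord u hB
      have hG : Measurable fun y => M.P y (S ∩ M.X u ⁻¹' B) := M.P.measurable_coe (hSm.inter hBm)
      rw [Measure.map_apply (M.measurable_coord _) hB,
        Measure.restrict_apply (M.measurable_coord _ hB)]
      have e1 : M.P x (M.X (t₀ + u) ⁻¹' B ∩ M.survival A s (t₀ + u + V)) =
          ∫⁻ ω in M.survival A s t₀, M.P (M.X t₀ ω) (S ∩ M.X u ⁻¹' B) ∂(M.P x) := by
        have := measure_survival_add_inter h.boundary x s t₀ (u + V) MeasurableSet.univ hBm
        simp only [Set.univ_inter] at this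
        rw [← this, add_assoc, Set.inter_comm]
        simp only [Set.preimage_preimage, M.shift]
      have hmle : ∀ y ∉ A (s + t₀), m B * M.P y S ≤ M.P y (S ∩ M.X u ⁻¹' B) := fun y hy => by
        have := hmx y hy B
        rwa [Measure.map_apply (M.measurable_coord _) hB,
          Measure.restrict_apply (M.measurable_coord _ hB), Measure.smul_apply, smul_eq_mul,
          mul_comm, Set.inter_comm] at this
      have key := h.convexComb_le (V := u + V) hx hG hmle
      rw [e1]
      refine le_trans (le_of_eq ?_) key
      simp only [Measure.add_apply, Measure.smul_apply, smul_eq_mul,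
        Measure.map_apply (M.measurable_coord u) hB, Measure.restrict_apply hBm]
      rw [Measure.bind_apply (hBm.inter hSm) M.P.measurable.aemeasurable, mul_comm, add_assoc,
        Set.inter_comm]

/-- The quotient of survival probabilities at `U + V` and `U` is the mean of `g (X U)` given
survival past `U`, where `g` is the probability of surviving a further time `V`. For `y` and `z`
these means share the part `∫ g dm`. The rest of `z`'s is at most `p * K`, where `K = N / c₂` bounds
`g`, and `K` is at most `(c₁ * c₂)⁻¹` times the mean for `y`. -/
lemma ratio_le_add (h : M.Minorization A t₀ ν c₁ c₂) (k : ℕ) {s U V : ℝ≥0} (hU : t₀ ≤ U)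
    (hk : k * t₀ ≤ U) {y z : E} (hy : y ∉ A s) (hz : z ∉ A s) :
    M.P z (M.survival A s (U + V)) * M.P y (M.survival A s U) ≤
      (1 + (1 - c₁ * c₂) ^ k * (c₁ * c₂)⁻¹) *
        (M.P y (M.survival A s (U + V)) * M.P z (M.survival A s U)) := by
  -- Conditioning stops at `U` itself, so `m` does not depend on `V`.
  obtain ⟨m, hm, hmx⟩ := h.exists_minorant k s U 0 hk
  simp only [add_zero] at hmx
  have hS := h.boundary.measurableSet_survival s U
  set g : E → ℝ≥0∞ := fun y => M.P y (M.survival A (s + U) V) with hg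
  have hgm : Measurable g := h.measurable_survival _ _
  set N := ∫⁻ y, g y ∂(ν (s + U)) with hN
  have hNt : N ≠ ∞ := ne_top_of_le_ne_top ENNReal.one_ne_top (h.lintegral_le_one _ _)
  have hc₁t : c₁ ≠ ∞ := ne_top_of_le_ne_top ENNReal.one_ne_top h.c₁_le
  have hc₂t : c₂ ≠ ∞ := ne_top_of_le_ne_top ENNReal.one_ne_top h.c₂_le
  have hK : N / c₂ ≠ ∞ := ENNReal.div_ne_top hNt h.c₂_pos.ne'
  have hgK : ∀ w ∉ A (s + U), g w ≤ N / c₂ := fun w hw => by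
    rw [ENNReal.le_div_iff_mul_le (Or.inl h.c₂_pos.ne') (Or.inl hc₂t), mul_comm]
    exact h.upper _ _ w hw
  have hX := M.measurable_coord U
  have hmap : ∀ x ∉ A s, ∀ f : E → ℝ≥0∞, Measurable f → M.P x (M.survival A s U) * ∫⁻ w, f w ∂m ≤
      ∫⁻ ω in M.survival A s U, f (M.X U ω) ∂(M.P x) := fun x hx f hf => by
    have := lintegral_mono' (hmx x hx) (le_refl f)
    rwa [lintegral_smul_measure, lintegral_map hf hX, smul_eq_mul] at this
  have hmA : ∀ᵐ w ∂m, w ∉ A (s + U) := by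
    rw [← measure_eq_zero_iff_ae_notMem]
    have h1 := hmx z hz (A (s + U))
    have he : M.X U ⁻¹' A (s + U) ∩ M.survival A s U = ∅ :=
      Set.eq_empty_of_forall_notMem fun ω hω => coord_notMem_of_mem_survival hω.2 hω.1
    rw [Measure.map_apply hX (h.boundary.measurableSet _),
      Measure.restrict_apply (hX (h.boundary.measurableSet _)), he, measure_empty, Measure.smul_apply,
      smul_eq_mul, nonpos_iff_eq_zero, mul_eq_zero] at h1
    exact h1.resolve_left (h.boundary.pos _ _ z hz).ne'
  have hm1 : m Set.univ ≠ ∞ := by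
    intro htop
    have := hmap z hz (fun _ => 1) measurable_const
    rw [lintegral_one, htop, ENNReal.mul_top (h.boundary.pos _ _ z hz).ne', setLIntegral_const,
      one_mul, top_le_iff] at this
    exact measure_ne_top _ _ this
  have hint : ∀ x, ∫⁻ ω in M.survival A s U, g (M.X U ω) ∂(M.P x) =
      M.P x (M.survival A s (U + V)) := fun x => by
    simpa only [Set.univ_inter] using
      (measure_survival_add h.boundary x s U V MeasurableSet.univ).symm
  set K := N / c₂ with hKdef
  set p := (1 - c₁ * c₂) ^ k with hp
  have hdm : Measurable fun w => K - g w := measurable_const.sub hgm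
  have hdX : Measurable fun ω => K - g (M.X U ω) := hdm.comp hX
  -- The upper bound comes from applying the minorant to the nonnegative function `K - g`; the
  -- finiteness of `K`, `m` and `Z` allows the cancellation.
  have eup : M.P z (M.survival A s (U + V)) ≤
      M.P z (M.survival A s U) * (∫⁻ w, g w ∂m + p * K) := by
    set Z := M.P z (M.survival A s U) with hZ
    have hZt : Z ≠ ∞ := measure_ne_top _ _
    have f1 : M.P z (M.survival A s (U + V)) +
        ∫⁻ ω in M.survival A s U, (K - g (M.X U ω)) ∂(M.P z) = K * Z := by
      rw [← hint z, ← lintegral_add_right _ hdX, hZ, ← setLIntegral_const]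
      exact setLIntegral_congr_fun hS fun ω hω =>
        add_tsub_cancel_of_le (hgK _ (coord_notMem_of_mem_survival hω))
    have f2 : ∫⁻ w, g w ∂m + ∫⁻ w, (K - g w) ∂m = K * m Set.univ := by
      rw [← lintegral_add_right _ hdm, ← lintegral_const]
      refine lintegral_congr_ae ?_
      filter_upwards [hmA] with w hw using add_tsub_cancel_of_le (hgK w hw)
    have f3 := hmap z hz _ hdm
    have hfin : K * m Set.univ * Z ≠ ∞ := ENNReal.mul_ne_top (ENNReal.mul_ne_top hK hm1) hZt
    refine (ENNReal.add_le_add_iff_right hfin).1 ?_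
    calc M.P z (M.survival A s (U + V)) + K * m Set.univ * Z
        = M.P z (M.survival A s (U + V)) + Z * ∫⁻ w, (K - g w) ∂m + Z * ∫⁻ w, g w ∂m := by
          rw [← f2]; ring
      _ ≤ K * Z * 1 + Z * ∫⁻ w, g w ∂m := by
          rw [mul_one, ← f1]; gcongr
      _ ≤ K * Z * (m Set.univ + p) + Z * ∫⁻ w, g w ∂m := by gcongr
      _ = _ := by ring
  have elow : M.P y (M.survival A s U) * ∫⁻ w, g w ∂m ≤ M.P y (M.survival A s (U + V)) :=
    (hmap y hy g hgm).trans_eq (hint y)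
  have elow' : M.P y (M.survival A s U) * K ≤ (c₁ * c₂)⁻¹ * M.P y (M.survival A s (U + V)) := by
    have := h.lower_lintegral_of_le (s := s) hU y hgm
    rw [hint y] at this
    rw [ENNReal.mul_inv (Or.inr hc₂t) (Or.inr h.c₂_pos.ne')]
    calc M.P y (M.survival A s U) * K
        = c₁⁻¹ * c₁ * (M.P y (M.survival A s U) * K) := by
          rw [ENNReal.inv_mul_cancel h.c₁_pos.ne' hc₁t, one_mul]
      _ = c₁⁻¹ * c₂⁻¹ * (c₁ * M.P y (M.survival A s U) * N) := by
          rw [hKdef, div_eq_mul_inv]; ring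
      _ ≤ _ := by gcongr
  calc M.P z (M.survival A s (U + V)) * M.P y (M.survival A s U)
      ≤ M.P z (M.survival A s U) * (∫⁻ w, g w ∂m + p * K) * M.P y (M.survival A s U) := by gcongr
    _ = M.P z (M.survival A s U) * (M.P y (M.survival A s U) * ∫⁻ w, g w ∂m +
          p * (M.P y (M.survival A s U) * K)) := by ring
    _ ≤ M.P z (M.survival A s U) * (M.P y (M.survival A s (U + V)) +
          p * ((c₁ * c₂)⁻¹ * M.P y (M.survival A s (U + V)))) := by gcongr
    _ = _ := by ring

/-- The condition `1 ≤ k` ensures `t₀ ≤ k * t₀`, which `ratio_le_add` needs. -/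
lemma exists_pow_mul_le (h : M.Minorization A t₀ ν c₁ c₂) {C ε : ℝ≥0∞} (hC : C ≠ ∞) (hε : 0 < ε) :
    ∃ k : ℕ, 1 ≤ k ∧ (1 - c₁ * c₂) ^ k * C ≤ ε := by
  have hlt : 1 - c₁ * c₂ < 1 :=
    ENNReal.sub_lt_self ENNReal.one_ne_top one_ne_zero h.const_ne_zero
  have := ENNReal.Tendsto.mul_const (ENNReal.tendsto_pow_atTop_nhds_zero_of_lt_one hlt)
    (Or.inr hC)
  rw [zero_mul] at this
  obtain ⟨k, hk1, hk⟩ := ((eventually_ge_atTop 1).and (this.eventually (eventually_le_nhds hε))).exists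
  exact ⟨k, hk1, hk⟩

lemma eventually_ratio_le (h : M.Minorization A t₀ ν c₁ c₂) {r : ℝ≥0∞} (hr : 1 < r) :
    ∃ U₀ : ℝ≥0, ∀ U ≥ U₀, ∀ s V : ℝ≥0, ∀ y ∉ A s, ∀ z ∉ A s,
      M.P z (M.survival A s (U + V)) * M.P y (M.survival A s U) ≤
        r * (M.P y (M.survival A s (U + V)) * M.P z (M.survival A s U)) := by
  obtain ⟨k, hk1, hk⟩ := h.exists_pow_mul_le (C := (c₁ * c₂)⁻¹)
    (ENNReal.inv_ne_top.2 h.const_ne_zero) (tsub_pos_of_lt hr)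
  refine ⟨k * t₀, fun U hU s V y hy z hz => ?_⟩
  refine (h.ratio_le_add k ?_ hU hy hz).trans ?_
  · refine le_trans ?_ hU
    exact le_mul_of_one_le_left' (by exact_mod_cast hk1)
  · gcongr
    exact (add_le_add_right hk 1).trans_eq (add_tsub_cancel_of_le hr.le)

end MarkovProcess.Minorization
-- The limiting ratio of survival probabilities as an eigenfunction
namespace MarkovProcess

variable {E Ω : Type*} [MeasurableSpace E] [MeasurableSpace Ω] {M : MarkovProcess E Ω}
  {A : ℝ≥0 → Set E}

/-- The normalised limit of the survival probabilities `P y (τ_{A ∘ θ_s} > n)`, as `n → ∞`, relative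
to those of the point `z s`. -/
noncomputable def limitRatio (M : MarkovProcess E Ω) (A : ℝ≥0 → Set E) (z : ℝ≥0 → E) (s : ℝ≥0)
    (y : E) : ℝ≥0∞ :=
  liminf (fun n : ℕ => M.P y (M.survival A s n) / M.P (z s) (M.survival A s n)) atTop

/-- The survival probabilities of different points become proportional, uniformly. -/
structure AsymptoticRatio (M : MarkovProcess E Ω) (A : ℝ≥0 → Set E) (z : ℝ≥0 → E) : Prop where
  boundary : M.IsAbsorbingBoundary A
  notMem : ∀ s, z s ∉ A s
  ratio_le : ∀ r : ℝ≥0∞, 1 < r → ∃ U₀ : ℝ≥0, ∀ U ≥ U₀, ∀ s V : ℝ≥0, ∀ y ∉ A s, ∀ z ∉ A s,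
      M.P z (M.survival A s (U + V)) * M.P y (M.survival A s U) ≤
        r * (M.P y (M.survival A s (U + V)) * M.P z (M.survival A s U))

/-- The normalising factor of the conditioned laws. -/
noncomputable def limitMass (M : MarkovProcess E Ω) (A : ℝ≥0 → Set E) (z : ℝ≥0 → E) (s a : ℝ≥0)
    (x : E) : ℝ≥0∞ :=
  ∫⁻ ω in M.survival A s a, M.limitRatio A z (s + a) (M.X a ω) ∂(M.P x)

namespace AsymptoticRatio

variable {z : ℝ≥0 → E}

lemma measurable_limitRatio (h : M.AsymptoticRatio A z) (s : ℝ≥0) :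
    Measurable (M.limitRatio A z s) :=
  Measurable.liminf fun n =>
    (M.P.measurable_coe (h.boundary.measurableSet_survival s n)).div_const _

/-- The finite-horizon comparison is uniform in `V`, so it passes to the `liminf`; convergence of
the ratios is never needed. -/
lemma exists_bounds (h : M.AsymptoticRatio A z) {r : ℝ≥0∞} (hr : 1 < r) (hr' : r ≠ ∞) :
    ∃ U₀ : ℝ≥0, ∀ U ≥ U₀, ∀ s : ℝ≥0, ∀ y ∉ A s,
      M.limitRatio A z s y * M.P (z s) (M.survival A s U) ≤ r * M.P y (M.survival A s U) ∧
      M.P y (M.survival A s U) ≤ r * (M.limitRatio A z s y * M.P (z s) (M.survival A s U)) := by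
  obtain ⟨U₀, hU₀⟩ := h.ratio_le r hr
  refine ⟨U₀, fun U hU s y hy => ?_⟩
  have hp : ∀ t, M.P (z s) (M.survival A s t) ≠ 0 := fun t =>
    (h.boundary.pos s t _ (h.notMem s)).ne'
  have ht : ∀ (w : E) t, M.P w (M.survival A s t) ≠ ∞ := fun w t => measure_ne_top _ _
  have hr0 : r ≠ 0 := (zero_lt_one.trans hr).ne'
  have hev : ∀ᶠ n : ℕ in atTop, ∃ V : ℝ≥0, (n : ℝ≥0) = U + V := by
    filter_upwards [tendsto_natCast_atTop_atTop.eventually_ge_atTop U] with n hn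
    exact exists_add_of_le hn
  constructor
  · rw [← ENNReal.le_div_iff_mul_le (Or.inl (hp U)) (Or.inl (ht _ U))]
    refine (liminf_le_liminf (v := fun _ : ℕ => r * M.P y (M.survival A s U) /
      M.P (z s) (M.survival A s U)) ?_).trans_eq (liminf_const _)
    filter_upwards [hev] with n ⟨V, hV⟩
    rw [ENNReal.le_div_iff_mul_le (Or.inl (hp U)) (Or.inl (ht _ U)), hV,
      ENNReal.mul_comm_div, ← mul_div_assoc,
      ENNReal.div_le_iff (hp _) (ht _ _)]
    refine le_trans (le_of_eq ?_) ((hU₀ U hU s V (z s) (h.notMem s) y hy).trans_eq ?_) <;> ring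
  · rw [← mul_assoc, ← ENNReal.div_le_iff (hp U) (ht _ U), mul_comm r, ← ENNReal.div_le_iff hr0 hr']
    refine le_liminf_of_le (by isBoundedDefault) ?_
    filter_upwards [hev] with n ⟨V, hV⟩
    rw [ENNReal.div_le_iff hr0 hr', ENNReal.div_le_iff (hp U) (ht _ U), hV,
      mul_assoc, ENNReal.mul_comm_div, ← mul_div_assoc,
      ENNReal.le_div_iff_mul_le (Or.inl (hp _)) (Or.inl (ht _ _))]
    refine le_trans (le_of_eq ?_) ((hU₀ U hU s V y hy (z s) (h.notMem s)).trans_eq ?_) <;> ring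

lemma exists_setLIntegral_bounds (h : M.AsymptoticRatio A z) {r : ℝ≥0∞} (hr : 1 < r) (hr' : r ≠ ∞) :
    ∃ U₀ : ℝ≥0, ∀ U ≥ U₀, ∀ s a : ℝ≥0, ∀ x : E, ∀ F, MeasurableSet[M.𝓕 a] F →
      (∫⁻ ω in F ∩ M.survival A s a, M.limitRatio A z (s + a) (M.X a ω) ∂(M.P x)) *
        M.P (z (s + a)) (M.survival A (s + a) U) ≤ r * M.P x (F ∩ M.survival A s (a + U)) ∧
      M.P x (F ∩ M.survival A s (a + U)) ≤ r *
        ((∫⁻ ω in F ∩ M.survival A s a, M.limitRatio A z (s + a) (M.X a ω) ∂(M.P x)) *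
        M.P (z (s + a)) (M.survival A (s + a) U)) := by
  obtain ⟨U₀, hU₀⟩ := h.exists_bounds hr hr'
  refine ⟨U₀, fun U hU s a x F hF => ?_⟩
  have hFm : MeasurableSet (F ∩ M.survival A s a) :=
    (M.𝓕.le a _ hF).inter (h.boundary.measurableSet_survival s a)
  have hm : Measurable fun ω => M.limitRatio A z (s + a) (M.X a ω) :=
    (h.measurable_limitRatio _).comp (M.measurable_coord a)
  have hm' : Measurable fun ω => M.P (M.X a ω) (M.survival A (s + a) U) :=
    (M.P.measurable_coe (h.boundary.measurableSet_survival _ _)).comp (M.measurable_coord a)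
  rw [measure_survival_add h.boundary x s a U hF, ← lintegral_mul_const _ hm,
    ← lintegral_const_mul _ hm', ← lintegral_const_mul _ (hm.mul_const _)]
  exact ⟨setLIntegral_mono' hFm fun ω hω =>
      (hU₀ U hU (s + a) _ (coord_notMem_of_mem_survival hω.2)).1,
    setLIntegral_mono' hFm fun ω hω =>
      (hU₀ U hU (s + a) _ (coord_notMem_of_mem_survival hω.2)).2⟩

lemma limitRatio_ne_zero (h : M.AsymptoticRatio A z) {s : ℝ≥0} {y : E} (hy : y ∉ A s) :
    M.limitRatio A z s y ≠ 0 := by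
  obtain ⟨U, hU⟩ := h.exists_bounds ENNReal.one_lt_two ENNReal.ofNat_ne_top
  intro h0
  have := (hU U le_rfl s y hy).2
  rw [h0, zero_mul, mul_zero] at this
  exact (h.boundary.pos s U y hy).not_ge this

lemma limitRatio_ne_top (h : M.AsymptoticRatio A z) {s : ℝ≥0} {y : E} (hy : y ∉ A s) :
    M.limitRatio A z s y ≠ ∞ := by
  obtain ⟨U, hU⟩ := h.exists_bounds ENNReal.one_lt_two ENNReal.ofNat_ne_top
  intro h0
  have := (hU U le_rfl s y hy).1
  rw [h0, ENNReal.top_mul (h.boundary.pos s U _ (h.notMem s)).ne', top_le_iff] at this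
  exact ENNReal.mul_ne_top ENNReal.ofNat_ne_top (measure_ne_top _ _) this

lemma limitMass_bounds (h : M.AsymptoticRatio A z) {r : ℝ≥0∞} (hr : 1 < r) (hr' : r ≠ ∞) :
    ∃ U₀ : ℝ≥0, ∀ U ≥ U₀, ∀ s a : ℝ≥0, ∀ x : E,
      M.limitMass A z s a x * M.P (z (s + a)) (M.survival A (s + a) U) ≤
        r * M.P x (M.survival A s (a + U)) ∧
      M.P x (M.survival A s (a + U)) ≤ r *
        (M.limitMass A z s a x * M.P (z (s + a)) (M.survival A (s + a) U)) := by
  obtain ⟨U₀, hU₀⟩ := h.exists_setLIntegral_bounds hr hr'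
  refine ⟨U₀, fun U hU s a x => ?_⟩
  simpa only [Set.univ_inter, limitMass] using hU₀ U hU s a x Set.univ MeasurableSet.univ

lemma limitMass_ne_zero (h : M.AsymptoticRatio A z) {s : ℝ≥0} (a : ℝ≥0) {x : E} (hx : x ∉ A s) :
    M.limitMass A z s a x ≠ 0 := by
  obtain ⟨U, hU⟩ := h.limitMass_bounds ENNReal.one_lt_two ENNReal.ofNat_ne_top
  intro h0
  have := (hU U le_rfl s a x).2
  rw [h0, zero_mul, mul_zero] at this
  exact (h.boundary.pos s _ x hx).not_ge this

lemma limitMass_ne_top (h : M.AsymptoticRatio A z) (s a : ℝ≥0) (x : E) :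
    M.limitMass A z s a x ≠ ∞ := by
  obtain ⟨U, hU⟩ := h.limitMass_bounds ENNReal.one_lt_two ENNReal.ofNat_ne_top
  intro h0
  have := (hU U le_rfl s a x).1
  rw [h0, ENNReal.top_mul (h.boundary.pos _ U _ (h.notMem _)).ne', top_le_iff] at this
  exact ENNReal.mul_ne_top ENNReal.ofNat_ne_top (measure_ne_top _ _) this

/-- Both `limitMass * p` and `limitRatio * q` approximate the survival probability up to `a + U`
within a factor `r`, with `p` and `q` independent of the starting point. Comparing at `x` and `y`
costs `r ^ 4`, and `r` tends to `1`. -/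
lemma limitMass_mul_le (h : M.AsymptoticRatio A z) {s : ℝ≥0} (a : ℝ≥0) {x y : E} (hx : x ∉ A s)
    (hy : y ∉ A s) : M.limitMass A z s a x * M.limitRatio A z s y ≤
      M.limitMass A z s a y * M.limitRatio A z s x := by
  have key : ∀ r : ℝ≥0∞, 1 < r → r ≠ ∞ → M.limitMass A z s a x * M.limitRatio A z s y ≤
      r ^ 4 * (M.limitMass A z s a y * M.limitRatio A z s x) := by
    intro r hr hr'
    obtain ⟨U₁, h₁⟩ := h.limitMass_bounds hr hr'
    obtain ⟨U₂, h₂⟩ := h.exists_bounds hr hr'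
    set U := max U₁ U₂
    have hx1 := h₁ U (le_max_left _ _) s a x
    have hy1 := h₁ U (le_max_left _ _) s a y
    have hx2 := h₂ (a + U) ((le_max_right _ _).trans le_add_self) s x hx
    have hy2 := h₂ (a + U) ((le_max_right _ _).trans le_add_self) s y hy
    set p := M.P (z (s + a)) (M.survival A (s + a) U)
    set q := M.P (z s) (M.survival A s (a + U))
    have hpq0 : p * q ≠ 0 := mul_ne_zero (h.boundary.pos _ _ _ (h.notMem _)).ne'
      (h.boundary.pos _ _ _ (h.notMem _)).ne'
    have hpqt : p * q ≠ ∞ := ENNReal.mul_ne_top (measure_ne_top _ _) (measure_ne_top _ _)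
    refine (ENNReal.mul_le_mul_iff_left hpq0 hpqt).1 ?_
    calc _ = (M.limitMass A z s a x * p) * (M.limitRatio A z s y * q) := by ring
      _ ≤ (r * M.P x (M.survival A s (a + U))) * (r * M.P y (M.survival A s (a + U))) :=
        mul_le_mul' hx1.1 hy2.1
      _ ≤ (r * (r * (M.limitRatio A z s x * q))) * (r * (r * (M.limitMass A z s a y * p))) := by
        gcongr
        exacts [hx2.2, hy1.2]
      _ = _ := by ring
  set c := M.limitMass A z s a y * M.limitRatio A z s x
  have hc : c ≠ ∞ := ENNReal.mul_ne_top (h.limitMass_ne_top _ _ _) (h.limitRatio_ne_top hx)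
  have hr : Tendsto (fun n : ℕ => 1 + (n + 1 : ℝ≥0∞)⁻¹) atTop (𝓝 (1 + 0)) := by
    refine tendsto_const_nhds.add ?_
    have := (tendsto_add_atTop_iff_nat 1).2 ENNReal.tendsto_inv_nat_nhds_zero
    simpa using this
  have hlim : Tendsto (fun n : ℕ => (1 + (n + 1 : ℝ≥0∞)⁻¹) ^ 4 * c) atTop (𝓝 ((1 + 0) ^ 4 * c)) :=
    ENNReal.Tendsto.mul_const (ENNReal.Tendsto.pow hr) (Or.inr hc)
  rw [add_zero, one_pow, one_mul] at hlim
  refine ge_of_tendsto' hlim fun n => key _ ?_ ?_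
  · exact ENNReal.lt_add_right ENNReal.one_ne_top (ENNReal.inv_ne_zero.2 (by finiteness))
  · exact ENNReal.add_ne_top.2 ⟨ENNReal.one_ne_top, ENNReal.inv_ne_top.2 (by simp)⟩

/-- This eigenfunction property is what makes the Doob transforms at different times consistent. -/
lemma exists_limitMass_eq (h : M.AsymptoticRatio A z) (s a : ℝ≥0) :
    ∃ l : ℝ≥0∞, l ≠ 0 ∧ l ≠ ∞ ∧ ∀ x ∉ A s, M.limitMass A z s a x = l * M.limitRatio A z s x := by
  have hz0 := h.limitRatio_ne_zero (h.notMem s)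
  have hzt := h.limitRatio_ne_top (h.notMem s)
  refine ⟨M.limitMass A z s a (z s) / M.limitRatio A z s (z s),
    ENNReal.div_ne_zero.2 ⟨h.limitMass_ne_zero a (h.notMem s), hzt⟩,
    ENNReal.div_ne_top (h.limitMass_ne_top _ _ _) hz0, fun x hx => ?_⟩
  rw [← ENNReal.mul_div_right_comm, ENNReal.eq_div_iff hz0 hzt, mul_comm]
  exact le_antisymm (h.limitMass_mul_le a hx (h.notMem s)) (h.limitMass_mul_le a (h.notMem s) hx)

end AsymptoticRatio

end MarkovProcess
-- The Doob transform and its Markov property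
namespace MarkovProcess

variable {E Ω : Type*} [MeasurableSpace E] [MeasurableSpace Ω] {M : MarkovProcess E Ω}
  {A : ℝ≥0 → Set E}

/-- `κ s a x`, restricted to `𝓕 a`, is the limit of `P x` given `τ_{A ∘ θ_s} > a + T` as `T → ∞`, and
these laws form an inhomogeneous Markov family. -/
structure IsConditionedFamily (M : MarkovProcess E Ω) (A : ℝ≥0 → Set E)
    (κ : ℝ≥0 → ℝ≥0 → Kernel E Ω) : Prop where
  boundary : M.IsAbsorbingBoundary A
  isMarkovKernel : ∀ s a, IsMarkovKernel (κ s a)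
  ae_notMem : ∀ s a, ∀ x ∉ A s, ∀ᵐ ω ∂(κ s a x), M.X a ω ∉ A (s + a)
  exists_cond_le : ∀ r : ℝ≥0∞, 1 < r → r ≠ ∞ → ∃ U₀ : ℝ≥0, ∀ U ≥ U₀, ∀ s a : ℝ≥0, ∀ x ∉ A s,
    ∀ F, MeasurableSet[M.𝓕 a] F → (M.P x)[F | M.survival A s (a + U)] ≤ r * κ s a x F
  markov : ∀ s a b, ∀ x ∉ A s, ∀ F B, MeasurableSet[M.𝓕 a] F → MeasurableSet B →
    κ s (a + b) x (F ∩ M.θ a ⁻¹' B) = ∫⁻ ω in F, κ (s + a) b (M.X a ω) B ∂(κ s a x)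

namespace AsymptoticRatio

variable {z : ℝ≥0 → E}

/-- The density of the conditioned law on `𝓕 a` with respect to `P x`. -/
noncomputable def _root_.MarkovProcess.limitDensity (M : MarkovProcess E Ω) (A : ℝ≥0 → Set E)
    (z : ℝ≥0 → E) (s a : ℝ≥0) (x : E) (ω : Ω) : ℝ≥0∞ :=
  (M.limitMass A z s a x)⁻¹ *
    (M.survival A s a).indicator (fun ω => M.limitRatio A z (s + a) (M.X a ω)) ω

lemma measurable_indicator_limitRatio (h : M.AsymptoticRatio A z) (s a : ℝ≥0) :
    Measurable ((M.survival A s a).indicator fun ω => M.limitRatio A z (s + a) (M.X a ω)) :=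
  ((h.measurable_limitRatio _).comp (M.measurable_coord a)).indicator
    (h.boundary.measurableSet_survival s a)

lemma measurable_limitMass (h : M.AsymptoticRatio A z) (s a : ℝ≥0) :
    Measurable (M.limitMass A z s a) := by
  have : M.limitMass A z s a = fun x =>
      ∫⁻ ω, (M.survival A s a).indicator (fun ω => M.limitRatio A z (s + a) (M.X a ω)) ω ∂(M.P x) :=
    funext fun x => (lintegral_indicator (h.boundary.measurableSet_survival s a) _).symm
  rw [this]
  exact (h.measurable_indicator_limitRatio s a).lintegral_kernel

lemma measurable_limitDensity (h : M.AsymptoticRatio A z) (s a : ℝ≥0) :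
    Measurable (Function.uncurry (M.limitDensity A z s a)) :=
  ((h.measurable_limitMass s a).inv.comp measurable_fst).mul
    ((h.measurable_indicator_limitRatio s a).comp measurable_snd)

open Classical in
/-- The conditioned laws, extended by `P x` to the points `x ∈ A s`. -/
noncomputable def conditionedKernel (h : M.AsymptoticRatio A z) (s a : ℝ≥0) : Kernel E Ω :=
  Kernel.piecewise (h.boundary.measurableSet s) M.P (M.P.withDensity (M.limitDensity A z s a))

open Classical in
lemma conditionedKernel_eq (h : M.AsymptoticRatio A z) (s a : ℝ≥0) {x : E} (hx : x ∉ A s) :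
    h.conditionedKernel s a x = (M.P x).withDensity (M.limitDensity A z s a x) := by
  rw [conditionedKernel, Kernel.piecewise_apply, if_neg hx,
    Kernel.withDensity_apply _ (h.measurable_limitDensity s a)]

lemma setLIntegral_conditionedKernel (h : M.AsymptoticRatio A z) (s a : ℝ≥0) {x : E} (hx : x ∉ A s)
    {F : Set Ω} (hF : MeasurableSet F) {f : Ω → ℝ≥0∞} (hf : Measurable f) :
    ∫⁻ ω in F, f ω ∂(h.conditionedKernel s a x) = (M.limitMass A z s a x)⁻¹ *
      ∫⁻ ω in F ∩ M.survival A s a, M.limitRatio A z (s + a) (M.X a ω) * f ω ∂(M.P x) := by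
  have hS := h.boundary.measurableSet_survival s a
  have hm : Measurable (M.limitDensity A z s a x) :=
    Measurable.of_uncurry_left (h.measurable_limitDensity s a)
  have hr : Measurable fun ω => M.limitRatio A z (s + a) (M.X a ω) :=
    (h.measurable_limitRatio _).comp (M.measurable_coord a)
  have hrf : Measurable fun ω => M.limitRatio A z (s + a) (M.X a ω) * f ω := hr.mul hf
  have e : ∫⁻ ω in F, f ω ∂((M.P x).withDensity (M.limitDensity A z s a x)) =
      ∫⁻ ω in F, M.limitDensity A z s a x ω * f ω ∂(M.P x) :=
    setLIntegral_withDensity_eq_setLIntegral_mul _ hm hf hF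
  rw [h.conditionedKernel_eq s a hx, e, ← lintegral_const_mul _ hrf, Set.inter_comm F,
    ← Measure.restrict_restrict hS, ← lintegral_indicator hS]
  refine lintegral_congr fun ω => ?_
  by_cases hω : ω ∈ M.survival A s a
  · simp only [limitDensity, Set.indicator_of_mem hω, mul_assoc]
  · simp only [limitDensity, Set.indicator_of_notMem hω, mul_zero, zero_mul]

lemma conditionedKernel_apply (h : M.AsymptoticRatio A z) (s a : ℝ≥0) {x : E} (hx : x ∉ A s)
    {F : Set Ω} (hF : MeasurableSet F) :
    h.conditionedKernel s a x F = (M.limitMass A z s a x)⁻¹ *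
      ∫⁻ ω in F ∩ M.survival A s a, M.limitRatio A z (s + a) (M.X a ω) ∂(M.P x) := by
  simpa using h.setLIntegral_conditionedKernel s a hx hF (f := fun _ => 1) measurable_const

open Classical in
lemma isMarkovKernel_conditionedKernel (h : M.AsymptoticRatio A z) (s a : ℝ≥0) :
    IsMarkovKernel (h.conditionedKernel s a) := by
  refine ⟨fun x => ⟨?_⟩⟩
  by_cases hx : x ∈ A s
  · rw [conditionedKernel, Kernel.piecewise_apply, if_pos hx, measure_univ]
  · rw [h.conditionedKernel_apply s a hx MeasurableSet.univ, Set.univ_inter]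
    exact ENNReal.inv_mul_cancel (h.limitMass_ne_zero a hx) (h.limitMass_ne_top s a x)

lemma ae_notMem_conditionedKernel (h : M.AsymptoticRatio A z) (s a : ℝ≥0) {x : E} (hx : x ∉ A s) :
    ∀ᵐ ω ∂(h.conditionedKernel s a x), M.X a ω ∉ A (s + a) := by
  have hm := M.measurable_coord a (h.boundary.measurableSet (s + a))
  change h.conditionedKernel s a x {ω | ¬ M.X a ω ∉ A (s + a)} = 0
  have he : {ω | ¬ M.X a ω ∉ A (s + a)} = M.X a ⁻¹' A (s + a) := by ext; simp
  have he' : M.X a ⁻¹' A (s + a) ∩ M.survival A s a = ∅ :=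
    Set.eq_empty_of_forall_notMem fun ω hω => coord_notMem_of_mem_survival hω.2 hω.1
  rw [he, h.conditionedKernel_apply s a hx hm, he']
  simp

/-- Numerator and denominator of the conditional probability are each within a factor `r` of their
limiting forms; the reference survival probability `q` cancels. -/
lemma exists_cond_le (h : M.AsymptoticRatio A z) {r : ℝ≥0∞} (hr : 1 < r) (hr' : r ≠ ∞) :
    ∃ U₀ : ℝ≥0, ∀ U ≥ U₀, ∀ s a : ℝ≥0, ∀ x ∉ A s, ∀ F, MeasurableSet[M.𝓕 a] F →
      (M.P x)[F | M.survival A s (a + U)] ≤ r ^ 2 * h.conditionedKernel s a x F := by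
  obtain ⟨U₁, h₁⟩ := h.exists_setLIntegral_bounds hr hr'
  obtain ⟨U₂, h₂⟩ := h.limitMass_bounds hr hr'
  refine ⟨max U₁ U₂, fun U hU s a x hx F hF => ?_⟩
  have e1 := (h₁ U ((le_max_left _ _).trans hU) s a x F hF).2
  have e2 := (h₂ U ((le_max_right _ _).trans hU) s a x).1
  have hp := (h.boundary.pos s (a + U) x hx).ne'
  have hD0 := h.limitMass_ne_zero a hx
  have hDt := h.limitMass_ne_top s a x
  rw [cond_apply (h.boundary.measurableSet_survival _ _), Set.inter_comm,
    h.conditionedKernel_apply s a hx (M.𝓕.le a _ hF), mul_comm, ← div_eq_mul_inv,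
    ENNReal.div_le_iff hp (measure_ne_top _ _)]
  refine (ENNReal.mul_le_mul_iff_right hD0 hDt).1 ?_
  set D := M.limitMass A z s a x
  set I := ∫⁻ ω in F ∩ M.survival A s a, M.limitRatio A z (s + a) (M.X a ω) ∂(M.P x)
  set q := M.P (z (s + a)) (M.survival A (s + a) U)
  set P := M.P x (M.survival A s (a + U))
  calc D * M.P x (F ∩ M.survival A s (a + U)) ≤ D * (r * (I * q)) := by gcongr
    _ = r * I * (D * q) := by ring
    _ ≤ r * I * (r * P) := by gcongr
    _ = r ^ 2 * 1 * I * P := by ring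
    _ = r ^ 2 * (D * D⁻¹) * I * P := by rw [ENNReal.mul_inv_cancel hD0 hDt]
    _ = _ := by ring

/-- The normalisation of the inner kernel is `l` times `limitRatio`, so the density at the
intermediate time reappears and only the constant `l` is left over. -/
lemma conditionedKernel_markov (h : M.AsymptoticRatio A z) (s a b : ℝ≥0) {x : E} (hx : x ∉ A s)
    {F B : Set Ω} (hF : MeasurableSet[M.𝓕 a] F) (hB : MeasurableSet B) :
    h.conditionedKernel s (a + b) x (F ∩ M.θ a ⁻¹' B) =
      ∫⁻ ω in F, h.conditionedKernel (s + a) b (M.X a ω) B ∂(h.conditionedKernel s a x) := by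
  have hF' := M.𝓕.le a _ hF
  have hS := h.boundary.measurableSet_survival
  obtain ⟨l, hl0, hlt, hl⟩ := h.exists_limitMass_eq (s + a) b
  have hκ : Measurable fun ω => h.conditionedKernel (s + a) b (M.X a ω) B :=
    (Kernel.measurable_coe _ hB).comp (M.measurable_coord a)
  have hr : Measurable fun ω => M.limitRatio A z (s + a) (M.X a ω) :=
    (h.measurable_limitRatio _).comp (M.measurable_coord a)
  have hrb : Measurable fun ω => M.limitRatio A z (s + (a + b)) (M.X b ω) :=
    (h.measurable_limitRatio _).comp (M.measurable_coord b)
  -- Stated for general `G` and `C` so that the choice of the whole space gives the normalising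
  -- constant over `a + b`, in which the same `l` occurs.
  have inner : ∀ G, MeasurableSet[M.𝓕 a] G → ∀ C, MeasurableSet C →
      ∫⁻ ω in (G ∩ M.θ a ⁻¹' C) ∩ M.survival A s (a + b),
        M.limitRatio A z (s + (a + b)) (M.X (a + b) ω) ∂(M.P x) =
      l * ∫⁻ ω in G ∩ M.survival A s a,
        M.limitRatio A z (s + a) (M.X a ω) * h.conditionedKernel (s + a) b (M.X a ω) C
          ∂(M.P x) := by
    intro G hG C hC
    have hκ : Measurable fun ω => h.conditionedKernel (s + a) b (M.X a ω) C :=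
      (Kernel.measurable_coe _ hC).comp (M.measurable_coord a)
    have e := setLIntegral_survival_add h.boundary x s a b hG (hrb.indicator hC)
    have hGS : MeasurableSet (G ∩ M.survival A s (a + b)) := (M.𝓕.le a _ hG).inter (hS _ _)
    have e' : ∫⁻ ω in (G ∩ M.θ a ⁻¹' C) ∩ M.survival A s (a + b),
        M.limitRatio A z (s + (a + b)) (M.X (a + b) ω) ∂(M.P x) =
        ∫⁻ ω in G ∩ M.survival A s (a + b), C.indicator
          (fun ω => M.limitRatio A z (s + (a + b)) (M.X b ω)) (M.θ a ω) ∂(M.P x) := by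
      rw [Set.inter_right_comm, Set.inter_comm, ← Measure.restrict_restrict
        (M.measurable_shift a hC), ← lintegral_indicator (M.measurable_shift a hC)]
      refine lintegral_congr fun ω => ?_
      by_cases hω : M.θ a ω ∈ C
      · rw [Set.indicator_of_mem (show ω ∈ M.θ a ⁻¹' C from hω), Set.indicator_of_mem hω, M.shift]
      · rw [Set.indicator_of_notMem (show ω ∉ M.θ a ⁻¹' C from hω), Set.indicator_of_notMem hω]
    have hrκ : Measurable fun ω => M.limitRatio A z (s + a) (M.X a ω) *
        h.conditionedKernel (s + a) b (M.X a ω) C := hr.mul hκ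
    rw [e', e, ← lintegral_const_mul _ hrκ]
    refine setLIntegral_congr_fun ((M.𝓕.le a _ hG).inter (hS _ _)) fun ω hω => ?_
    have hy := coord_notMem_of_mem_survival hω.2
    have hm0 := h.limitMass_ne_zero b hy
    have hmt := h.limitMass_ne_top (s + a) b (M.X a ω)
    rw [h.conditionedKernel_apply _ _ hy hC, lintegral_indicator hC,
      Measure.restrict_restrict hC, ← mul_assoc, ← hl _ hy, ← mul_assoc,
      ENNReal.mul_inv_cancel hm0 hmt, one_mul, add_assoc]
  have hD : M.limitMass A z s (a + b) x = l * M.limitMass A z s a x := by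
    have e := inner Set.univ MeasurableSet.univ Set.univ MeasurableSet.univ
    have : ∀ y, h.conditionedKernel (s + a) b y Set.univ = 1 := fun y =>
      (h.isMarkovKernel_conditionedKernel _ _).isProbabilityMeasure y |>.measure_univ
    simpa [this, limitMass] using e
  rw [h.conditionedKernel_apply _ _ hx (hF'.inter (M.measurable_shift a hB)), inner F hF B hB,
    h.setLIntegral_conditionedKernel _ _ hx hF' hκ, hD, ENNReal.mul_inv (Or.inl hl0) (Or.inl hlt),
    mul_mul_mul_comm, ENNReal.inv_mul_cancel hl0 hlt, one_mul]

lemma isConditionedFamily (h : M.AsymptoticRatio A z) :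
    M.IsConditionedFamily A h.conditionedKernel where
  boundary := h.boundary
  isMarkovKernel := h.isMarkovKernel_conditionedKernel
  ae_notMem s a _ hx := h.ae_notMem_conditionedKernel s a hx
  exists_cond_le r hr hr' := by
    obtain ⟨n, hn1, hn⟩ : ∃ p : ℝ≥0∞, 1 < p ∧ p ^ 2 ≤ r := by
      refine ⟨r ^ (1 / 2 : ℝ), ENNReal.one_lt_rpow hr (by norm_num), ?_⟩
      rw [← ENNReal.rpow_natCast, ← ENNReal.rpow_mul]
      norm_num
    have hnt : n ≠ ∞ := by
      rintro rfl
      exact hr' (by simpa using hn)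
    obtain ⟨U₀, hU₀⟩ := h.exists_cond_le hn1 hnt
    exact ⟨U₀, fun U hU s a x hx F hF => (hU₀ U hU s a x hx F hF).trans (by gcongr)⟩
  markov s a b _ hx _ _ hF hB := h.conditionedKernel_markov s a b hx hF hB

end AsymptoticRatio

lemma Minorization.exists_isConditionedFamily {t₀ : ℝ≥0} {ν : ℝ≥0 → Measure E} {c₁ c₂ : ℝ≥0∞}
    (h : M.Minorization A t₀ ν c₁ c₂) : ∃ κ, M.IsConditionedFamily A κ := by
  choose z hz using fun s => have := h.isProbabilityMeasure s; (h.ae_notMem s).exists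
  exact ⟨_, AsymptoticRatio.isConditionedFamily
    ⟨h.boundary, hz, fun _ hr => h.eventually_ratio_le hr⟩⟩

end MarkovProcess
-- Total variation estimates through common minorants
/-- Two measures have a common minorant of mass at least `1 - ε`. -/
def HasCommonMinorant {α : Type*} [MeasurableSpace α] (ε : ℝ≥0∞) (μ μ' : Measure α) : Prop :=
  ∃ m : Measure α, m ≤ μ ∧ m ≤ μ' ∧ 1 ≤ m Set.univ + ε

namespace HasCommonMinorant

variable {α : Type*} [MeasurableSpace α] {μ μ' : Measure α} {ε : ℝ≥0∞}

lemma symm (h : HasCommonMinorant ε μ μ') : HasCommonMinorant ε μ' μ :=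
  let ⟨m, h1, h2, h3⟩ := h; ⟨m, h2, h1, h3⟩

lemma map {β : Type*} [MeasurableSpace β] (h : HasCommonMinorant ε μ μ') {g : α → β}
    (hg : Measurable g) : HasCommonMinorant ε (μ.map g) (μ'.map g) := by
  obtain ⟨m, h1, h2, h3⟩ := h
  refine ⟨m.map g, Measure.map_mono h1 hg, Measure.map_mono h2 hg, ?_⟩
  rwa [Measure.map_apply hg MeasurableSet.univ, Set.preimage_univ]

lemma measure_le_add [IsProbabilityMeasure μ] (h : HasCommonMinorant ε μ μ') {B : Set α}
    (hB : MeasurableSet B) : μ B ≤ μ' B + ε := by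
  obtain ⟨m, h1, h2, h3⟩ := h
  have hf : μ Bᶜ ≠ ∞ := measure_ne_top _ _
  refine (ENNReal.add_le_add_iff_right hf).1 ?_
  calc μ B + μ Bᶜ = 1 := by rw [measure_add_measure_compl hB, measure_univ]
    _ ≤ m B + m Bᶜ + ε := by rwa [measure_add_measure_compl hB]
    _ ≤ μ' B + μ Bᶜ + ε := by gcongr
    _ = _ := by ring

lemma abs_integral_sub_le [IsProbabilityMeasure μ] [IsProbabilityMeasure μ']
    (h : HasCommonMinorant ε μ μ') (hε : ε ≠ ∞) {f : α → ℝ} (hf : Measurable f) {C : ℝ}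
    (hC : ∀ a, |f a| ≤ C) : |∫ a, f a ∂μ - ∫ a, f a ∂μ'| ≤ 2 * C * ε.toReal := by
  obtain ⟨m, h1, h2, h3⟩ := h
  have hC0 : 0 ≤ C := by
    obtain ⟨a⟩ := nonempty_of_isProbabilityMeasure μ
    exact (abs_nonneg _).trans (hC a)
  have : IsFiniteMeasure m := isFiniteMeasure_of_le μ h1
  have key : ∀ ρ : Measure α, IsProbabilityMeasure ρ → m ≤ ρ →
      |∫ a, f a ∂ρ - ∫ a, f a ∂m| ≤ C * ε.toReal := by
    intro ρ hρ hmρ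
    have hfin : IsFiniteMeasure (ρ - m) := inferInstance
    have hi : ∀ (τ : Measure α) [IsFiniteMeasure τ], Integrable f τ := fun τ _ =>
      Integrable.of_bound hf.aestronglyMeasurable C (ae_of_all _ hC)
    have e : ∫ a, f a ∂ρ = ∫ a, f a ∂(ρ - m) + ∫ a, f a ∂m := by
      rw [← integral_add_measure (hi _) (hi _), Measure.sub_add_cancel_of_le hmρ]
    have hmass : (ρ - m).real Set.univ ≤ ε.toReal := by
      refine ENNReal.toReal_mono hε ?_
      rw [Measure.sub_apply MeasurableSet.univ hmρ, measure_univ]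
      exact tsub_le_iff_left.2 h3
    rw [e, add_sub_cancel_right]
    have := norm_integral_le_of_norm_le_const (μ := ρ - m) (f := f) (ae_of_all _ hC)
    rw [Real.norm_eq_abs] at this
    exact this.trans (by gcongr)
  have k1 := key μ inferInstance h1
  have k2 := key μ' inferInstance h2
  rw [abs_le] at k1 k2 ⊢
  constructor <;> linarith [k1.1, k1.2, k2.1, k2.2]

lemma eq_of_forall [IsProbabilityMeasure μ] [IsProbabilityMeasure μ']
    (h : ∀ ε : ℝ≥0∞, 0 < ε → ε ≠ ∞ → HasCommonMinorant ε μ μ') : μ = μ' := by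
  ext B hB
  refine le_antisymm ?_ ?_ <;> refine ENNReal.le_of_forall_pos_le_add fun ε hε _ => ?_
  · exact (h ε (by exact_mod_cast hε) ENNReal.coe_ne_top).measure_le_add hB
  · exact (h ε (by exact_mod_cast hε) ENNReal.coe_ne_top).symm.measure_le_add hB

end HasCommonMinorant

namespace MarkovProcess

variable {E Ω : Type*} [MeasurableSpace E] [MeasurableSpace Ω] {M : MarkovProcess E Ω}
  {A : ℝ≥0 → Set E} {κ : ℝ≥0 → ℝ≥0 → Kernel E Ω}

lemma isProbabilityMeasure_cond_survival (hA : M.IsAbsorbingBoundary A) (s t : ℝ≥0) {x : E}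
    (hx : x ∉ A s) : IsProbabilityMeasure ((M.P x)[|M.survival A s t]) :=
  cond_isProbabilityMeasure (hA.pos s t x hx).ne'

/-- Domination of the conditioned law by `(1 - δ)⁻¹ * κ s a x` on `𝓕 a` makes `1 - δ` times that law
a minorant of both. -/
lemma IsConditionedFamily.exists_hasCommonMinorant (h : M.IsConditionedFamily A κ) {ε : ℝ≥0∞}
    (hε : 0 < ε) (β : Type*) [MeasurableSpace β] : ∃ U₀ : ℝ≥0, ∀ U ≥ U₀, ∀ s a : ℝ≥0, ∀ x ∉ A s,
      ∀ g : Ω → β, Measurable[M.𝓕 a] g →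
        HasCommonMinorant ε (((M.P x)[|M.survival A s (a + U)]).map g) ((κ s a x).map g) := by
  obtain ⟨δ, hδ0, hδ⟩ := exists_between (lt_min hε one_pos)
  have hδε : δ ≤ ε := hδ.le.trans (min_le_left _ _)
  have hδ1 : δ < 1 := hδ.trans_le (min_le_right _ _)
  have h1δ : 1 - δ ≠ 0 := (tsub_pos_of_lt hδ1).ne'
  have h1δt : 1 - δ ≠ ∞ := ne_top_of_le_ne_top ENNReal.one_ne_top tsub_le_self
  have hr : 1 < (1 - δ)⁻¹ :=
    ENNReal.one_lt_inv.2 (ENNReal.sub_lt_self ENNReal.one_ne_top one_ne_zero hδ0.ne')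
  obtain ⟨U₀, hU₀⟩ := h.exists_cond_le _ hr (ENNReal.inv_ne_top.2 h1δ)
  refine ⟨U₀, fun U hU s a x hx g hg => ?_⟩
  have hg' : Measurable g := hg.mono (M.𝓕.le a) le_rfl
  have := isProbabilityMeasure_cond_survival h.boundary s (a + U) hx
  refine ⟨(1 - δ) • ((M.P x)[|M.survival A s (a + U)]).map g, ?_, ?_, ?_⟩
  · refine Measure.le_iff.2 fun B _ => ?_
    rw [Measure.smul_apply, smul_eq_mul]
    exact mul_le_of_le_one_left' tsub_le_self
  · refine Measure.le_iff.2 fun B hB => ?_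
    rw [Measure.smul_apply, smul_eq_mul, Measure.map_apply hg' hB, Measure.map_apply hg' hB]
    calc _ ≤ (1 - δ) * ((1 - δ)⁻¹ * κ s a x (g ⁻¹' B)) := by
          gcongr; exact hU₀ U hU s a x hx _ (hg hB)
      _ = _ := by rw [← mul_assoc, ENNReal.mul_inv_cancel h1δ h1δt, one_mul]
  · rw [Measure.smul_apply, Measure.map_apply hg' MeasurableSet.univ, Set.preimage_univ,
      measure_univ, smul_eq_mul, mul_one]
    exact tsub_le_iff_right.1 (tsub_le_tsub_left hδε 1)

/-! ### Ionescu-Tulcea construction of the Q-process -/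

/-- The transition kernels of a chain of trajectories of length one under the conditioned laws. -/
noncomputable def chainKernel (M : MarkovProcess E Ω) (κ : ℝ≥0 → ℝ≥0 → Kernel E Ω) (s : ℝ≥0)
    (n : ℕ) : Kernel (Finset.Iic n → Ω) Ω :=
  (κ (s + (n + 1)) 1).comap (fun h => M.X 1 (h ⟨n, Finset.mem_Iic.2 le_rfl⟩))
    ((M.measurable_coord 1).comp (measurable_pi_apply _))

/-- The path obtained by following each of `N + 1` trajectories during a unit of time, and the last
one from then on. -/
noncomputable def concat (M : MarkovProcess E Ω) (N : ℕ) (h : Finset.Iic N → Ω) (t : ℝ≥0) : E :=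
  M.X (t - (min ⌊t⌋₊ N : ℕ)) (h ⟨min ⌊t⌋₊ N, Finset.mem_Iic.2 (min_le_right _ _)⟩)

lemma measurable_concat (M : MarkovProcess E Ω) (N : ℕ) : Measurable (M.concat N) :=
  measurable_pi_lambda _ fun _ => (M.measurable_coord _).comp (measurable_pi_apply _)

lemma measurable_path (M : MarkovProcess E Ω) : Measurable fun ω t => M.X t ω :=
  measurable_pi_lambda _ fun t => M.measurable_coord t

/-- Follow the path `p` up to the time `a`, and the trajectory of `ω` afterwards. -/
noncomputable def glue (M : MarkovProcess E Ω) (a : ℝ≥0) (q : (ℝ≥0 → E) × Ω) (t : ℝ≥0) : E :=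
  if t < a then q.1 t else M.X (t - a) q.2

lemma measurable_glue (M : MarkovProcess E Ω) (a : ℝ≥0) : Measurable (M.glue a) := by
  refine measurable_pi_lambda _ fun t => ?_
  unfold glue
  split_ifs
  · exact (measurable_pi_apply t).comp measurable_fst
  · exact (M.measurable_coord _).comp measurable_snd

lemma measurable_filtration_coord (M : MarkovProcess E Ω) {t a : ℝ≥0} (h : t ≤ a) :
    Measurable[M.𝓕 a] (M.X t) :=
  (M.adapted t).mono (M.𝓕.mono h) le_rfl

/-- The law of the chain of trajectories of length one. -/
noncomputable def chainLaw (M : MarkovProcess E Ω) (κ : ℝ≥0 → ℝ≥0 → Kernel E Ω)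
    [∀ s a, IsMarkovKernel (κ s a)] (s : ℝ≥0) (x : E) : Measure (ℕ → Ω) :=
  have : ∀ n, IsMarkovKernel (M.chainKernel κ s n) := fun n => by
    unfold chainKernel; infer_instance
  Kernel.trajMeasure (X := fun _ => Ω) (κ s 1 x) (M.chainKernel κ s)

instance [∀ s a, IsMarkovKernel (κ s a)] (s : ℝ≥0) (n : ℕ) :
    IsMarkovKernel (M.chainKernel κ s n) := by
  unfold chainKernel; infer_instance

instance [∀ s a, IsMarkovKernel (κ s a)] (s : ℝ≥0) (x : E) :
    IsProbabilityMeasure (M.chainLaw κ s x) := by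
  unfold chainLaw; infer_instance

lemma chainLaw_map_zero [∀ s a, IsMarkovKernel (κ s a)] (s : ℝ≥0) (x : E) :
    ((M.chainLaw κ s x).map (Preorder.frestrictLe 0)).map (fun h => h ⟨0, Finset.mem_Iic.2 le_rfl⟩)
      = κ s 1 x := by
  unfold chainLaw
  rw [Kernel.trajMeasure, Measure.map_comp _ _ (by fun_prop), Kernel.traj_map_frestrictLe,
    Kernel.partialTraj_self, Measure.id_comp, Measure.map_map (by fun_prop) (by fun_prop)]
  exact Measure.map_id

lemma chainLaw_compProd [∀ s a, IsMarkovKernel (κ s a)] (s : ℝ≥0) (x : E) (N : ℕ) :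
    ((M.chainLaw κ s x).map (Preorder.frestrictLe N)) ⊗ₘ M.chainKernel κ s N =
      (M.chainLaw κ s x).map (fun w => (Preorder.frestrictLe N w, w (N + 1))) :=
  Kernel.map_frestrictLe_trajMeasure_compProd_eq_map_trajMeasure (X := fun _ => Ω)

end MarkovProcess
namespace MarkovProcess

variable {E Ω : Type*} [MeasurableSpace E] [MeasurableSpace Ω] {M : MarkovProcess E Ω}
  {A : ℝ≥0 → Set E} {κ : ℝ≥0 → ℝ≥0 → Kernel E Ω}

lemma concat_end (M : MarkovProcess E Ω) (N : ℕ) (h : Finset.Iic N → Ω) :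
    M.concat N h (N + 1) = M.X 1 (h ⟨N, Finset.mem_Iic.2 le_rfl⟩) := by
  have h1 : min ⌊(N : ℝ≥0) + 1⌋₊ N = N := by
    rw [Nat.floor_add_one (Nat.cast_nonneg _), Nat.floor_natCast]; omega
  simp [concat, h1]

lemma concat_succ (M : MarkovProcess E Ω) (N : ℕ) (w : ℕ → Ω) :
    M.concat (N + 1) (Preorder.frestrictLe (π := fun _ => Ω) (N + 1) w) = M.glue (N + 1)
      (fun t => M.concat N (Preorder.frestrictLe (π := fun _ => Ω) N w) (min t (N + 1)),
        w (N + 1)) := by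
  funext t
  simp only [concat, glue, Preorder.frestrictLe_apply]
  split_ifs with ht
  · have h1 : ⌊t⌋₊ < N + 1 := (Nat.floor_lt' (Nat.succ_ne_zero N)).2 (by exact_mod_cast ht)
    rw [min_eq_left ht.le, min_eq_left h1.le, min_eq_left (Nat.lt_succ_iff.1 h1)]
  · have h1 : N + 1 ≤ ⌊t⌋₊ := Nat.le_floor (by exact_mod_cast not_lt.1 ht)
    rw [min_eq_right h1]
    push_cast
    rfl

lemma glue_path (M : MarkovProcess E Ω) (a : ℝ≥0) (ω : Ω) :
    M.glue a (fun t => M.X (min t a) ω, M.θ a ω) = fun t => M.X t ω := by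
  funext t
  simp only [glue]
  split_ifs with ht
  · rw [min_eq_left ht.le]
  · rw [M.shift, add_tsub_cancel_of_le (not_lt.1 ht)]

lemma measurable_filtration_segment (M : MarkovProcess E Ω) {ι : Type*} {g : ι → ℝ≥0} {a : ℝ≥0}
    (hg : ∀ i, g i ≤ a) : Measurable[M.𝓕 a] fun ω i => M.X (g i) ω :=
  @measurable_pi_lambda Ω ι (fun _ => E) (M.𝓕 a) _ _ fun i => M.measurable_filtration_coord (hg i)

/-- By induction on the number of pieces, adding one by the Markov property of `κ`. Pieces cannot be
joined inside the abstract space `Ω`, so the laws are compared on paths. -/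
lemma IsConditionedFamily.chainLaw_map_concat (h : M.IsConditionedFamily A κ)
    [∀ s a, IsMarkovKernel (κ s a)] {s : ℝ≥0} {x : E} (hx : x ∉ A s) (N : ℕ) :
    ((M.chainLaw κ s x).map (Preorder.frestrictLe N)).map (M.concat N) =
      (κ s (N + 1) x).map fun ω t => M.X t ω := by
  induction N with
  | zero =>
    have e : M.concat 0 = (fun ω t => M.X t ω) ∘
        fun h : Finset.Iic 0 → Ω => h ⟨0, Finset.mem_Iic.2 le_rfl⟩ := by
      funext h t
      have : min ⌊t⌋₊ 0 = 0 := by simp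
      simp [concat]
    rw [e, ← Measure.map_map M.measurable_path (measurable_pi_apply _), chainLaw_map_zero]
    simp
  | succ N ih =>
    set μ := M.chainLaw κ s x with hμ
    set a : ℝ≥0 := N + 1 with ha
    -- Freezing the past at time `a` makes it `𝓕 a`-measurable, as the Markov property requires;
    -- `glue` then recovers the full path from the frozen past and the new piece.
    have hhalt : Measurable fun (p : ℝ≥0 → E) (t : ℝ≥0) => p (min t a) :=
      measurable_pi_lambda _ fun t => measurable_pi_apply _
    have hφ : Measurable fun q : (Finset.Iic N → Ω) × Ω =>
        ((fun t => M.concat N q.1 (min t a), q.2) : (ℝ≥0 → E) × Ω) :=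
      ((hhalt.comp (M.measurable_concat N)).comp measurable_fst).prodMk measurable_snd
    have hψ : Measurable fun ω => ((fun t => M.X (min t a) ω, M.θ a ω) : (ℝ≥0 → E) × Ω) :=
      (hhalt.comp M.measurable_path).prodMk (M.measurable_shift a)
    have hψF : Measurable[M.𝓕 a] fun ω (t : ℝ≥0) => M.X (min t a) ω :=
      M.measurable_filtration_segment fun t => min_le_right t a
    have joint : (μ.map fun w => (Preorder.frestrictLe (π := fun _ => Ω) N w, w (N + 1))).map
          (fun q => ((fun t => M.concat N q.1 (min t a), q.2) : (ℝ≥0 → E) × Ω)) =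
        (κ s (a + 1) x).map fun ω => (fun t => M.X (min t a) ω, M.θ a ω) := by
      have : IsProbabilityMeasure
          (μ.map fun w => (Preorder.frestrictLe (π := fun _ => Ω) N w, w (N + 1))) :=
        Measure.isProbabilityMeasure_map (by fun_prop)
      have := Measure.isProbabilityMeasure_map (μ := (μ.map fun w =>
        (Preorder.frestrictLe (π := fun _ => Ω) N w, w (N + 1)))) hφ.aemeasurable
      refine Measure.ext_prod fun {B₁ B₂} hB₁ hB₂ => ?_
      have hC : MeasurableSet {p : ℝ≥0 → E | (fun t => p (min t a)) ∈ B₁} := hhalt hB₁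
      have hC' := M.measurable_concat N hC
      have hκ : Measurable fun p : ℝ≥0 → E => κ (s + a) 1 (p a) B₂ :=
        (Kernel.measurable_coe _ hB₂).comp (measurable_pi_apply a)
      rw [Measure.map_apply hφ (hB₁.prod hB₂), Measure.map_apply hψ (hB₁.prod hB₂),
        ← chainLaw_compProd]
      have e1 : (fun q : (Finset.Iic N → Ω) × Ω =>
          ((fun t => M.concat N q.1 (min t a), q.2) : (ℝ≥0 → E) × Ω)) ⁻¹' (B₁ ×ˢ B₂) =
          (M.concat N ⁻¹' {p | (fun t => p (min t a)) ∈ B₁}) ×ˢ B₂ := rfl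
      have e2 : (fun ω => ((fun t => M.X (min t a) ω, M.θ a ω) : (ℝ≥0 → E) × Ω)) ⁻¹' (B₁ ×ˢ B₂) =
          ((fun ω (t : ℝ≥0) => M.X (min t a) ω) ⁻¹' B₁) ∩ M.θ a ⁻¹' B₂ := rfl
      have e3 : ∀ q, M.chainKernel κ s N q B₂ = κ (s + a) 1 (M.concat N q a) B₂ := fun q => by
        rw [ha, concat_end]; rfl
      rw [e1, e2, Measure.compProd_apply_prod hC' hB₂, h.markov s a 1 x hx _ _ (hψF hB₁) hB₂]
      simp_rw [e3]
      rw [← setLIntegral_map hC hκ (M.measurable_concat N), ih,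
        setLIntegral_map hC hκ M.measurable_path]
      rfl
    have e : (μ.map (Preorder.frestrictLe (π := fun _ => Ω) (N + 1))).map (M.concat (N + 1)) =
        ((μ.map fun w => (Preorder.frestrictLe (π := fun _ => Ω) N w, w (N + 1))).map
          (fun q => ((fun t => M.concat N q.1 (min t a), q.2) : (ℝ≥0 → E) × Ω))).map
            (M.glue a) := by
      rw [Measure.map_map (M.measurable_concat _) (by fun_prop),
        Measure.map_map hφ (by fun_prop), Measure.map_map (M.measurable_glue a)
        (hφ.comp (by fun_prop))]
      congr 1
      funext w
      exact M.concat_succ N w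
    rw [e, joint, Measure.map_map (M.measurable_glue a) hψ]
    have : (((N + 1 : ℕ) : ℝ≥0) + 1) = a + 1 := by rw [ha]; push_cast; rfl
    rw [this]
    congr 1
    funext ω
    exact M.glue_path a ω

/-- The law of the path started from `x` at time `s`, built from the conditioned laws. -/
noncomputable def pathLaw (M : MarkovProcess E Ω) (κ : ℝ≥0 → ℝ≥0 → Kernel E Ω)
    [∀ s a, IsMarkovKernel (κ s a)] (s : ℝ≥0) (x : E) : Measure (ℝ≥0 → E) :=
  (M.chainLaw κ s x).map fun w t => M.X (t - s - (⌊t - s⌋₊ : ℕ)) (w ⌊t - s⌋₊)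

lemma measurable_chainPath (M : MarkovProcess E Ω) (s : ℝ≥0) : Measurable
    fun (w : ℕ → Ω) (t : ℝ≥0) => M.X (t - s - (⌊t - s⌋₊ : ℕ)) (w ⌊t - s⌋₊) :=
  measurable_pi_lambda _ fun _ => (M.measurable_coord _).comp (measurable_pi_apply _)

lemma measurable_segment {ι : Type*} {E : Type*} [MeasurableSpace E] (g : ι → ℝ≥0) :
    Measurable fun (p : ℝ≥0 → E) (u : ι) => p (g u) :=
  measurable_pi_lambda _ fun _ => measurable_pi_apply _

/-- Up to time `t ≤ N` the path reads only the pieces `0, …, N`. -/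
lemma IsConditionedFamily.pathLaw_map_segment (h : M.IsConditionedFamily A κ)
    [∀ s a, IsMarkovKernel (κ s a)] {s : ℝ≥0} {x : E} (hx : x ∉ A s) {t : ℝ≥0} {N : ℕ}
    (hN : t ≤ N) :
    (M.pathLaw κ s x).map (fun w (u : Set.Icc (0 : ℝ≥0) t) => w (s + u)) =
      (κ s (N + 1) x).map (fun ω (u : Set.Icc (0 : ℝ≥0) t) => M.X u ω) := by
  have e : (κ s (N + 1) x).map (fun ω (u : Set.Icc (0 : ℝ≥0) t) => M.X u ω) =
      ((κ s (N + 1) x).map fun ω t => M.X t ω).map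
        (fun p (u : Set.Icc (0 : ℝ≥0) t) => p u) := by
    rw [Measure.map_map (measurable_segment _) M.measurable_path]; rfl
  rw [e, ← h.chainLaw_map_concat hx N, pathLaw,
    Measure.map_map (measurable_segment _) (M.measurable_chainPath s),
    Measure.map_map (M.measurable_concat N) (by fun_prop),
    Measure.map_map (measurable_segment _) ((M.measurable_concat N).comp (by fun_prop))]
  congr 1
  funext w u
  have hu : ⌊(u : ℝ≥0)⌋₊ ≤ N := Nat.floor_le_of_le (u.2.2.trans hN)
  simp only [Function.comp_apply, concat, Preorder.frestrictLe_apply, add_tsub_cancel_left,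
    min_eq_left hu]

lemma IsConditionedFamily.isQProcessFamily_pathLaw [TopologicalSpace E]
    (h : M.IsConditionedFamily A κ) [∀ s a, IsMarkovKernel (κ s a)] :
    M.IsQProcessFamily A (M.pathLaw κ) := by
  intro s x hx
  refine ⟨Measure.isProbabilityMeasure_map (M.measurable_chainPath s).aemeasurable,
    fun t f hf => ?_⟩
  obtain ⟨N, hN⟩ := exists_nat_ge t
  rw [h.pathLaw_map_segment hx hN]
  have hseg : ∀ a : ℝ≥0, t ≤ a →
      Measurable[M.𝓕 a] fun ω (u : Set.Icc (0 : ℝ≥0) t) => M.X u ω := fun a ha =>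
    M.measurable_filtration_segment fun u => u.2.2.trans ha
  have hseg' : Measurable fun ω (u : Set.Icc (0 : ℝ≥0) t) => M.X u ω :=
    measurable_pi_lambda _ fun u => M.measurable_coord u
  have := Measure.isProbabilityMeasure_map (μ := κ s (N + 1) x) hseg'.aemeasurable
  rw [Metric.tendsto_atTop]
  intro η hη
  set δ : ℝ := η / (4 * (‖f‖ + 1)) with hδ
  have hf0 := norm_nonneg f
  have hδ0 : 0 < δ := by positivity
  obtain ⟨U₀, hU₀⟩ := h.exists_hasCommonMinorant (ε := ENNReal.ofReal δ)
    (ENNReal.ofReal_pos.2 hδ0) (Set.Icc (0 : ℝ≥0) t → E)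
  -- The segment is read at time `N + 1`, and survival is still required for at least `U₀` beyond
  -- it.
  refine ⟨(N + 1) + U₀, fun T hT => ?_⟩
  obtain ⟨V, rfl⟩ := exists_add_of_le hT
  have e : t + (N + 1 + U₀ + V) = (N + 1) + (U₀ + V + t) := by ring
  have := isProbabilityMeasure_cond_survival h.boundary s (N + 1 + (U₀ + V + t)) hx
  have := Measure.isProbabilityMeasure_map
    (μ := (M.P x)[|M.survival A s (N + 1 + (U₀ + V + t))]) hseg'.aemeasurable
  beta_reduce
  rw [e, Real.dist_eq]
  have hcm := hU₀ (U₀ + V + t) (by rw [add_assoc]; exact le_self_add) s (N + 1) x hx _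
    (hseg (N + 1) (hN.trans le_self_add))
  refine (hcm.abs_integral_sub_le ENNReal.ofReal_ne_top hf
    (C := ‖f‖) fun a => f.norm_coe_le_norm a).trans_lt ?_
  rw [ENNReal.toReal_ofReal hδ0.le, hδ]
  rw [mul_div_assoc', div_lt_iff₀ (by positivity)]
  nlinarith

end MarkovProcess
-- Uniqueness of the Q-process from time zero, and consistency of `κ`
lemma measure_ext_of_integral_prod {ι : Type*} [Fintype ι] {E : Type*} [MetricSpace E]
    [MeasurableSpace E] [BorelSpace E] {μ ν : Measure (ι → E)} [IsFiniteMeasure μ]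
    [IsFiniteMeasure ν] (h : ∀ f : ι → E →ᵇ ℝ, ∫ p, ∏ i, f i (p i) ∂μ = ∫ p, ∏ i, f i (p i) ∂ν) :
    μ = ν := by
  -- A dummy factor `Unit` brings the measures into the form of a product with one extra space.
  have hm : Measurable fun p : ι → E => (p, ()) := measurable_id.prodMk measurable_const
  have key : μ.map (fun p => (p, ())) = ν.map (fun p => (p, ())) := by
    refine Measure.ext_of_integral_prod_mul_boundedContinuousFunction (X := fun _ => E)
      fun f g => ?_
    have hs : AEStronglyMeasurable (fun q : (ι → E) × Unit => (∏ i, f i (q.1 i)) * g q.2)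
        (μ.map (fun p => (p, ())) + ν.map (fun p => (p, ()))) := by
      refine Measurable.aestronglyMeasurable ?_
      refine Measurable.mul (Finset.measurable_prod _ fun i _ => ?_) ?_
      · exact (f i).continuous.measurable.comp ((measurable_pi_apply i).comp measurable_fst)
      · exact g.continuous.measurable.comp measurable_snd
    rw [integral_map hm.aemeasurable (hs.mono_measure (Measure.le_add_right le_rfl)),
      integral_map hm.aemeasurable (hs.mono_measure (Measure.le_add_left le_rfl))]
    simp only [integral_mul_const, h]
  have := congrArg (Measure.map Prod.fst) key
  rwa [Measure.map_map measurable_fst hm, Measure.map_map measurable_fst hm,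
    Function.comp_def, Measure.map_id', Measure.map_id'] at this

namespace MarkovProcess

variable {E Ω : Type*} [MeasurableSpace Ω]

/-- Products of bounded continuous functions of finitely many coordinates are admissible tests, and
they determine the finite-dimensional laws. The starting time is `0` because a Q-process started at
`s > 0` is unconstrained before `s`. -/
lemma IsQProcessFamily.apply_zero_eq [MetricSpace E] [MeasurableSpace E] [BorelSpace E]
    {M : MarkovProcess E Ω} {A : ℝ≥0 → Set E} {Q Q' : ℝ≥0 → E → Measure (ℝ≥0 → E)}
    (hQ : M.IsQProcessFamily A Q) (hQ' : M.IsQProcessFamily A Q') {x : E} (hx : x ∉ A 0) :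
    Q 0 x = Q' 0 x := by
  have := (hQ 0 x hx).1
  have := (hQ' 0 x hx).1
  have hmarg : ∀ I : Finset ℝ≥0, (Q 0 x).map I.restrict = (Q' 0 x).map I.restrict := by
    intro I
    have hI : Measurable (I.restrict (π := fun _ => E)) := by fun_prop
    have hmem : ∀ i : I, (i : ℝ≥0) ∈ Set.Icc (0 : ℝ≥0) (I.sup id) := fun i =>
      ⟨zero_le, Finset.le_sup (f := id) i.2⟩
    have hseg : Measurable fun (p : ℝ≥0 → E) (u : Set.Icc (0 : ℝ≥0) (I.sup id)) => p (0 + u) :=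
      measurable_segment _
    have := Measure.isProbabilityMeasure_map (μ := Q 0 x) hI.aemeasurable
    have := Measure.isProbabilityMeasure_map (μ := Q' 0 x) hI.aemeasurable
    refine measure_ext_of_integral_prod fun f => ?_
    let F : (Set.Icc (0 : ℝ≥0) (I.sup id) → E) →ᵇ ℝ :=
      ∏ i : I, (f i).compContinuous ⟨fun q => q ⟨i, hmem i⟩, continuous_apply _⟩
    have hF : ∀ q, F q = ∏ i : I, f i (q ⟨i, hmem i⟩) := fun q => by
      simp [F]
    have hfm : Measurable fun p : I → E => ∏ i, f i (p i) :=
      Finset.measurable_prod _ fun i _ => (f i).continuous.measurable.comp (measurable_pi_apply i)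
    have hFm : Measurable F := by
      rw [show (F : _ → ℝ) = fun q => ∏ i : I, f i (q ⟨i, hmem i⟩) from funext hF]
      exact Finset.measurable_prod _ fun i _ =>
        (f i).continuous.measurable.comp (measurable_pi_apply _)
    have e := tendsto_nhds_unique ((hQ 0 x hx).2 (I.sup id) F hFm)
      ((hQ' 0 x hx).2 (I.sup id) F hFm)
    rw [integral_map hseg.aemeasurable hFm.aestronglyMeasurable,
      integral_map hseg.aemeasurable hFm.aestronglyMeasurable] at e
    rw [integral_map hI.aemeasurable hfm.aestronglyMeasurable,
      integral_map hI.aemeasurable hfm.aestronglyMeasurable]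
    simpa only [hF, zero_add, Finset.restrict] using e
  have h1 : IsProjectiveLimit (Q 0 x) fun I => (Q' 0 x).map I.restrict := hmarg
  have h2 : IsProjectiveLimit (Q' 0 x) fun I => (Q' 0 x).map I.restrict := fun _ => rfl
  exact h1.unique h2

variable [MeasurableSpace E] {M : MarkovProcess E Ω} {A : ℝ≥0 → Set E}
  {κ : ℝ≥0 → ℝ≥0 → Kernel E Ω}

/-- Both sides approximate the same law conditioned on a distant survival event. This serves twice:
to change the time `a`, and to shift `s` by a period. -/
lemma IsConditionedFamily.map_eq_map (h : M.IsConditionedFamily A κ) {s s' a a' : ℝ≥0}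
    (hs : M.survival A s = M.survival A s') {x : E} (hx : x ∉ A s) (hx' : x ∉ A s')
    {β : Type*} [MeasurableSpace β] {g : Ω → β} (hg : Measurable[M.𝓕 a] g)
    (hg' : Measurable[M.𝓕 a'] g) : (κ s a x).map g = (κ s' a' x).map g := by
  have := h.isMarkovKernel
  have hgm : Measurable g := hg.mono (M.𝓕.le a) le_rfl
  have key : ∀ s s' a a' : ℝ≥0, M.survival A s = M.survival A s' → x ∉ A s → x ∉ A s' →
      Measurable[M.𝓕 a] g → Measurable[M.𝓕 a'] g → ∀ B, MeasurableSet B →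
      (κ s a x).map g B ≤ (κ s' a' x).map g B := by
    intro s s' a a' hs hx hx' hg hg' B hB
    refine ENNReal.le_of_forall_pos_le_add fun ε hε _ => ?_
    have hε2 : (0 : ℝ≥0∞) < ε / 2 := ENNReal.half_pos (by exact_mod_cast hε.ne')
    obtain ⟨U₀, hU₀⟩ := h.exists_hasCommonMinorant hε2 β
    -- The two margins are chosen so that both conditionings have the horizon `a + a' + U₀`.
    have h1 := hU₀ (U₀ + a') le_self_add s a x hx g hg
    have h2 := hU₀ (U₀ + a) le_self_add s' a' x hx' g hg'
    rw [← hs, show a' + (U₀ + a) = a + (U₀ + a') by ring] at h2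
    have := isProbabilityMeasure_cond_survival h.boundary s (a + (U₀ + a')) hx
    have := Measure.isProbabilityMeasure_map (μ := κ s a x) hgm.aemeasurable
    have := Measure.isProbabilityMeasure_map (μ := (M.P x)[|M.survival A s (a + (U₀ + a'))])
      hgm.aemeasurable
    calc (κ s a x).map g B ≤ _ + ε / 2 := h1.symm.measure_le_add hB
      _ ≤ (κ s' a' x).map g B + ε / 2 + ε / 2 := by gcongr; exact h2.measure_le_add hB
      _ = _ := by rw [add_assoc, ENNReal.add_halves]
  ext B hB
  exact le_antisymm (key _ _ _ _ hs hx hx' hg hg' B hB) (key _ _ _ _ hs.symm hx' hx hg' hg B hB)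

/-! ### Transition kernels of the Q-process -/

/-- The transition kernels of the process under the conditioned laws. -/
noncomputable def transition (M : MarkovProcess E Ω) (κ : ℝ≥0 → ℝ≥0 → Kernel E Ω) (s u : ℝ≥0) :
    Kernel E E :=
  (κ s u).map (M.X u)

instance [∀ s a, IsMarkovKernel (κ s a)] (s u : ℝ≥0) : IsMarkovKernel (M.transition κ s u) :=
  Kernel.IsMarkovKernel.map _ (M.measurable_coord u)

lemma transition_apply (M : MarkovProcess E Ω) (κ : ℝ≥0 → ℝ≥0 → Kernel E Ω) (s u : ℝ≥0) (x : E) :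
    M.transition κ s u x = (κ s u x).map (M.X u) :=
  Kernel.map_apply _ (M.measurable_coord u) _

lemma measurable_pathLaw [∀ s a, IsMarkovKernel (κ s a)] (s : ℝ≥0) :
    Measurable (M.pathLaw κ s) := by
  unfold pathLaw chainLaw Kernel.trajMeasure
  refine (Measure.measurable_map _ (M.measurable_chainPath s)).comp ?_
  refine (Measure.measurable_bind' (Kernel.measurable _)).comp ?_
  exact (Measure.measurable_map _ (MeasurableEquiv.measurable _)).comp (κ s 1).measurable

lemma measurable_eval (u : ℝ≥0) : Measurable fun w : ℝ≥0 → E => w u := measurable_pi_apply u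

namespace IsConditionedFamily

lemma pathLaw_map_eval (h : M.IsConditionedFamily A κ) [∀ s a, IsMarkovKernel (κ s a)] {x : E}
    (hx : x ∉ A 0) {u a : ℝ≥0} (hua : u ≤ a) :
    (M.pathLaw κ 0 x).map (fun w => w u) = (κ 0 a x).map (M.X u) := by
  obtain ⟨N, hN⟩ := exists_nat_ge u
  have hu : u ∈ Set.Icc (0 : ℝ≥0) u := ⟨zero_le, le_rfl⟩
  have hm : Measurable fun q : Set.Icc (0 : ℝ≥0) u → E => q ⟨u, hu⟩ := measurable_pi_apply _
  have e := congrArg (Measure.map fun q : Set.Icc (0 : ℝ≥0) u → E => q ⟨u, hu⟩)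
    (h.pathLaw_map_segment hx hN)
  rw [Measure.map_map hm (measurable_segment _),
    Measure.map_map hm (measurable_pi_lambda _ fun v => M.measurable_coord v)] at e
  have e2 := h.map_eq_map rfl hx hx (M.measurable_filtration_coord (hN.trans le_self_add))
    (M.measurable_filtration_coord hua) (a := N + 1)
  rw [← e2]
  refine Eq.trans ?_ e
  congr 1
  funext w
  simp

/-- Equality almost everywhere with the measurable family `pathLaw κ 0` stands in for measurability
of `Q` in the starting point. -/
lemma bind_map_eval [MetricSpace E] [BorelSpace E] (h : M.IsConditionedFamily A κ)
    {Q : ℝ≥0 → E → Measure (ℝ≥0 → E)} (hQ : M.IsQProcessFamily A Q) {β : Measure E}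
    (hβ : β (A 0) = 0) (u : ℝ≥0) :
    (β.bind (Q 0)).map (fun w => w u) = β.bind (M.transition κ 0 u) := by
  have := h.isMarkovKernel
  have hae : ∀ᵐ x ∂β, x ∉ A 0 := measure_eq_zero_iff_ae_notMem.1 hβ
  have e : Q 0 =ᵐ[β] M.pathLaw κ 0 := by
    filter_upwards [hae] with x hx using hQ.apply_zero_eq h.isQProcessFamily_pathLaw hx
  rw [Measure.bind_congr_right e]
  ext B hB
  rw [Measure.map_apply (measurable_eval u) hB,
    Measure.bind_apply (measurable_eval u hB) (measurable_pathLaw 0).aemeasurable,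
    Measure.bind_apply hB (Kernel.measurable _).aemeasurable]
  refine lintegral_congr_ae ?_
  filter_upwards [hae] with x hx
  rw [transition_apply, ← h.pathLaw_map_eval hx le_rfl, Measure.map_apply (measurable_eval u) hB]

lemma transition_add (h : M.IsConditionedFamily A κ) {s : ℝ≥0} (u v : ℝ≥0) {x : E} (hx : x ∉ A s) :
    M.transition κ s (u + v) x = (M.transition κ s u x).bind (M.transition κ (s + u) v) := by
  ext B hB
  have hBm := M.measurable_coord v hB
  have e : M.X (u + v) ⁻¹' B = Set.univ ∩ M.θ u ⁻¹' (M.X v ⁻¹' B) := by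
    ext ω; simp [M.shift]
  rw [Measure.bind_apply hB (Kernel.measurable _).aemeasurable, transition_apply, transition_apply,
    lintegral_map (Kernel.measurable_coe _ hB) (M.measurable_coord u),
    Measure.map_apply (M.measurable_coord _) hB, e,
    h.markov s u v x hx _ _ MeasurableSet.univ hBm, setLIntegral_univ]
  refine lintegral_congr fun ω => ?_
  rw [transition_apply, Measure.map_apply (M.measurable_coord _) hB]

lemma transition_eq (h : M.IsConditionedFamily A κ) {s s' : ℝ≥0} (hs : ∀ t, A (t + s) = A (t + s'))
    (u : ℝ≥0) {x : E} (hx : x ∉ A s) : M.transition κ s u x = M.transition κ s' u x := by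
  rw [transition_apply, transition_apply]
  have h0 := hs 0
  rw [zero_add, zero_add] at h0
  exact h.map_eq_map (survival_congr hs) hx (h0 ▸ hx) (M.adapted u) (M.adapted u)

lemma transition_ae_notMem (h : M.IsConditionedFamily A κ) {s : ℝ≥0} (u : ℝ≥0) {x : E}
    (hx : x ∉ A s) : ∀ᵐ y ∂(M.transition κ s u x), y ∉ A (s + u) := by
  rw [transition_apply, ae_map_iff (M.measurable_coord u).aemeasurable
    (h.boundary.measurableSet _).compl]
  exact h.ae_notMem s u x hx

lemma transition_add_of_periodic (h : M.IsConditionedFamily A κ) {s u : ℝ≥0} (v : ℝ≥0)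
    (hu : ∀ t, A (t + (s + u)) = A (t + s)) {x : E} (hx : x ∉ A s) :
    M.transition κ s (u + v) x = (M.transition κ s u x).bind (M.transition κ s v) := by
  rw [h.transition_add u v hx]
  refine Measure.bind_congr_right ?_
  filter_upwards [h.transition_ae_notMem u hx] with y hy using h.transition_eq hu v hy

/-- The minorant of the laws conditioned to survive past `u + U` passes to `κ` by domination. The
deficit `δ` of the minorant and the factor `1 - δ` lose at most `2 * δ ≤ ε` of mass. -/
lemma exists_transition_minorant (h : M.IsConditionedFamily A κ) {t₀ : ℝ≥0} {ν : ℝ≥0 → Measure E}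
    {c₁ c₂ : ℝ≥0∞} (hM : M.Minorization A t₀ ν c₁ c₂) {ε : ℝ≥0∞} (hε : 0 < ε) :
    ∃ T : ℝ≥0, ∀ s, ∀ u ≥ T, ∃ m : Measure E, 1 ≤ m Set.univ + ε ∧
      ∀ x ∉ A s, m ≤ M.transition κ s u x := by
  obtain ⟨δ, hδ0, hδ⟩ := exists_between (lt_min (ENNReal.half_pos hε.ne') one_pos)
  have hδε : δ ≤ ε / 2 := hδ.le.trans (min_le_left _ _)
  have hδ1 : δ < 1 := hδ.trans_le (min_le_right _ _)
  have h1δ : 1 - δ ≠ 0 := (tsub_pos_of_lt hδ1).ne'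
  have h1δt : 1 - δ ≠ ∞ := ne_top_of_le_ne_top ENNReal.one_ne_top tsub_le_self
  have hr : 1 < (1 - δ)⁻¹ :=
    ENNReal.one_lt_inv.2 (ENNReal.sub_lt_self ENNReal.one_ne_top one_ne_zero hδ0.ne')
  obtain ⟨k, -, hk⟩ := hM.exists_pow_mul_le (C := 1) ENNReal.one_ne_top hδ0
  obtain ⟨U, hU⟩ := h.exists_cond_le _ hr (ENNReal.inv_ne_top.2 h1δ)
  refine ⟨k * t₀, fun s u hu => ?_⟩
  obtain ⟨m, hm1, hm⟩ := hM.exists_minorant k s u U hu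
  refine ⟨(1 - δ) • m, ?_, fun x hx => ?_⟩
  · rw [mul_one] at hk
    rw [Measure.smul_apply, smul_eq_mul]
    calc (1 : ℝ≥0∞) = (1 - δ) * 1 + δ := by rw [mul_one, tsub_add_cancel_of_le hδ1.le]
      _ ≤ (1 - δ) * (m Set.univ + δ) + δ := by gcongr; exact hm1.trans (by gcongr)
      _ = (1 - δ) * m Set.univ + ((1 - δ) * δ + δ) := by ring
      _ ≤ (1 - δ) * m Set.univ + (1 * δ + δ) := by gcongr; exact tsub_le_self
      _ ≤ (1 - δ) * m Set.univ + (ε / 2 + ε / 2) := by rw [one_mul]; gcongr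
      _ = _ := by rw [ENNReal.add_halves]
  · refine Measure.le_iff.2 fun B hB => ?_
    have hX := M.measurable_coord u
    have h1 := hm x hx B
    have hp := (h.boundary.pos s (u + U) x hx).ne'
    have hBF : MeasurableSet[M.𝓕 u] (M.X u ⁻¹' B) := M.adapted u hB
    have h2 := hU U le_rfl s u x hx _ hBF
    rw [Measure.map_apply hX hB, Measure.restrict_apply (hX hB), Measure.smul_apply, smul_eq_mul,
      mul_comm, ← ENNReal.le_div_iff_mul_le (Or.inl hp) (Or.inl (measure_ne_top _ _)),
      div_eq_mul_inv, mul_comm, Set.inter_comm,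
      ← cond_apply (h.boundary.measurableSet_survival _ _)] at h1
    rw [transition_apply, Measure.map_apply hX hB, Measure.smul_apply, smul_eq_mul]
    calc _ ≤ (1 - δ) * ((1 - δ)⁻¹ * κ s u x (M.X u ⁻¹' B)) := by gcongr; exact h1.trans h2
      _ = _ := by rw [← mul_assoc, ENNReal.mul_inv_cancel h1δ h1δt, one_mul]

end IsConditionedFamily

end MarkovProcess
-- Invariant law of a semigroup that forgets its starting point
-- The supremum of the increasing sequence is realised as the sum of its increments.
lemma exists_isProbabilityMeasure_of_monotone {α : Type*} [MeasurableSpace α] {i : ℕ → Measure α}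
    (hi : Monotone i) (hle : ∀ j, i j Set.univ ≤ 1)
    (hmass : ∀ ε : ℝ≥0∞, 0 < ε → ∃ j, 1 ≤ i j Set.univ + ε) :
    ∃ β : Measure α, IsProbabilityMeasure β ∧ ∀ j, i j ≤ β := by
  have hfin : ∀ j, IsFiniteMeasure (i j) := fun j => ⟨(hle j).trans_lt ENNReal.one_lt_top⟩
  set d : ℕ → Measure α := fun j => Nat.casesOn j (i 0) fun k => i (k + 1) - i k with hd
  have hsum : ∀ B j, ∑ k ∈ Finset.range (j + 1), d k B = i j B := by
    intro B j
    induction j with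
    | zero => simp [hd]
    | succ j ih =>
      rw [Finset.sum_range_succ, ih, add_comm, ← Measure.add_apply,
        Measure.sub_add_cancel_of_le (hi j.le_succ)]
  have hge : ∀ j, i j ≤ Measure.sum d := fun j => Measure.le_iff.2 fun B hB => by
    rw [Measure.sum_apply _ hB, ← hsum B j]
    exact ENNReal.sum_le_tsum _
  refine ⟨Measure.sum d, ⟨le_antisymm ?_ ?_⟩, hge⟩
  · rw [Measure.sum_apply _ MeasurableSet.univ, ENNReal.tsum_eq_iSup_nat]
    refine iSup_le fun j => ?_
    cases j with
    | zero => simp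
    | succ j => rw [hsum]; exact hle j
  · refine ENNReal.le_of_forall_pos_le_add fun ε hε _ => ?_
    obtain ⟨j, hj⟩ := hmass ε (by exact_mod_cast hε)
    exact hj.trans (by gcongr; exact hge j)

lemma le_bind_of_ae_le {α β : Type*} [MeasurableSpace α] [MeasurableSpace β] {μ : Measure α}
    [IsProbabilityMeasure μ] {κ : Kernel α β} {m : Measure β} (h : ∀ᵐ x ∂μ, m ≤ κ x) :
    m ≤ μ.bind κ := by
  refine Measure.le_iff.2 fun B hB => ?_
  rw [Measure.bind_apply hB κ.measurable.aemeasurable]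
  calc m B = ∫⁻ _, m B ∂μ := by simp
    _ ≤ _ := lintegral_mono_ae (h.mono fun x hx => hx B)

lemma bind_mono_left {α β : Type*} [MeasurableSpace α] [MeasurableSpace β] {μ μ' : Measure α}
    (h : μ ≤ μ') (κ : Kernel α β) : μ.bind κ ≤ μ'.bind κ := by
  refine Measure.le_iff.2 fun B hB => ?_
  rw [Measure.bind_apply hB κ.measurable.aemeasurable,
    Measure.bind_apply hB κ.measurable.aemeasurable]
  exact lintegral_mono' h le_rfl

lemma bind_apply_univ {α β : Type*} [MeasurableSpace α] [MeasurableSpace β] (μ : Measure α)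
    (κ : Kernel α β) [IsMarkovKernel κ] : μ.bind κ Set.univ = μ Set.univ := by
  rw [Measure.bind_apply MeasurableSet.univ κ.measurable.aemeasurable]
  simp

section Skeleton

variable {E : Type*} [MeasurableSpace E] {L : ℕ → Kernel E E} {S : Set E}

/-- A family of kernels with the semigroup property that forgets its starting point, outside a null
set `S`, has an invariant probability measure. -/
lemma exists_invariant_of_minorant [∀ n, IsMarkovKernel (L n)] {x₀ : E} (hx₀ : x₀ ∉ S)
    (hS : ∀ n, ∀ x ∉ S, L n x S = 0) (hSm : MeasurableSet S)
    (hadd : ∀ k n, ∀ x ∉ S, L (k + n) x = (L k x).bind (L n))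
    (hL : ∀ ε : ℝ≥0∞, 0 < ε → ∃ N, ∀ n ≥ N, ∃ m : Measure E, 1 ≤ m Set.univ + ε ∧
      ∀ x ∉ S, m ≤ L n x) :
    ∃ β : Measure E, IsProbabilityMeasure β ∧ β S = 0 ∧ ∀ n, β = β.bind (L n) := by
  -- The part common to all laws from time `j` on. Its mass tends to `1`, since `L (n + N) x₀` is a
  -- mixture of the laws `L N y`, all above the same `m`. So the limit `β` exists without a
  -- completeness argument.
  set i : ℕ → Measure E := fun j => ⨅ n, L (j + n) x₀ with hi
  have hile : ∀ j n, j ≤ n → i j ≤ L n x₀ := fun j n hjn => by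
    obtain ⟨k, rfl⟩ := exists_add_of_le hjn
    exact iInf_le (fun n => L (j + n) x₀) k
  have hmono : Monotone i := monotone_nat_of_le_succ fun j => le_iInf fun n =>
    hile j _ (by omega)
  have hle : ∀ j, i j Set.univ ≤ 1 := fun j => (hile j j le_rfl _).trans prob_le_one
  have hmass : ∀ ε : ℝ≥0∞, 0 < ε → ∃ j, 1 ≤ i j Set.univ + ε := fun ε hε => by
    obtain ⟨N, hN⟩ := hL ε hε
    obtain ⟨m, hm1, hm⟩ := hN N le_rfl
    have hmi : m ≤ i N := by
      refine le_iInf fun n => ?_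
      rw [add_comm, hadd n N x₀ hx₀]
      refine le_bind_of_ae_le ?_
      filter_upwards [measure_eq_zero_iff_ae_notMem.1 (hS n x₀ hx₀)] with y hy using hm y hy
    exact ⟨N, hm1.trans (by gcongr)⟩
  obtain ⟨β, hβ, hβi⟩ := exists_isProbabilityMeasure_of_monotone hmono hle hmass
  refine ⟨β, hβ, ?_, fun n => ?_⟩
  · refine le_antisymm (ENNReal.le_of_forall_pos_le_add fun ε hε _ => ?_) zero_le
    obtain ⟨j, hj⟩ := hmass ε (by exact_mod_cast hε)
    have : HasCommonMinorant ε β (L j x₀) := ⟨i j, hβi j, hile j j le_rfl, hj⟩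
    simpa [hS j x₀ hx₀] using this.measure_le_add hSm
  · have : IsProbabilityMeasure (β.bind (L n)) := ⟨by rw [bind_apply_univ, measure_univ]⟩
    refine HasCommonMinorant.eq_of_forall fun ε hε _ => ?_
    obtain ⟨j, hj⟩ := hmass ε hε
    refine ⟨(i j).bind (L n), ?_, bind_mono_left (hβi j) _, by rwa [bind_apply_univ]⟩
    -- By the semigroup property, `i j` pushed forward by `L n` lies below `i (j + n)`, hence below
    -- `β`.
    refine le_trans (le_iInf fun k => ?_) (hβi (j + n))
    rw [show j + n + k = (j + k) + n by ring, hadd _ _ x₀ hx₀]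
    exact bind_mono_left (hile j _ (by omega)) _

lemma invariant_unique_of_minorant [∀ n, IsMarkovKernel (L n)]
    (hL : ∀ ε : ℝ≥0∞, 0 < ε → ∃ N, ∀ n ≥ N, ∃ m : Measure E, 1 ≤ m Set.univ + ε ∧
      ∀ x ∉ S, m ≤ L n x) {β β' : Measure E} [IsProbabilityMeasure β] [IsProbabilityMeasure β']
    (hβS : β S = 0) (hβS' : β' S = 0) (hβ : ∀ n, β = β.bind (L n))
    (hβ' : ∀ n, β' = β'.bind (L n)) : β = β' := by
  refine HasCommonMinorant.eq_of_forall fun ε hε _ => ?_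
  obtain ⟨N, hN⟩ := hL ε hε
  obtain ⟨m, hm1, hm⟩ := hN N le_rfl
  refine ⟨m, ?_, ?_, hm1⟩
  · rw [hβ N]
    exact le_bind_of_ae_le ((measure_eq_zero_iff_ae_notMem.1 hβS).mono hm)
  · rw [hβ' N]
    exact le_bind_of_ae_le ((measure_eq_zero_iff_ae_notMem.1 hβS').mono hm)

end Skeleton
-- Time averages
-- The integral over `[0, t]` differs from `t / γ` times that over a period by at most a constant
-- `K`.
lemma tendsto_average_of_periodic {φ : ℝ → ℝ} {γ : ℝ} (hγ : 0 < γ) (hφ : Function.Periodic φ γ)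
    (hint : IntervalIntegrable φ volume 0 γ) :
    Tendsto (fun t : ℝ => t⁻¹ * ∫ s in 0..t, φ s) atTop (𝓝 (γ⁻¹ * ∫ s in 0..γ, φ s)) := by
  set I := ∫ s in 0..γ, φ s with hI
  set a := sInf ((fun t => ∫ x in 0..t, φ x) '' Set.Icc 0 γ)
  set b := sSup ((fun t => ∫ x in 0..t, φ x) '' Set.Icc 0 γ)
  set K := |a| + |b| + |I| with hK
  have hlim : Tendsto (fun t : ℝ => K * t⁻¹) atTop (𝓝 0) := by
    simpa using tendsto_inv_atTop_zero.const_mul K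
  rw [tendsto_iff_dist_tendsto_zero]
  refine squeeze_zero' (Eventually.of_forall fun _ => dist_nonneg) ?_ hlim
  filter_upwards [eventually_gt_atTop 0] with t ht
  have h1 := hφ.sInf_add_zsmul_le_integral_of_pos hint hγ t
  have h2 := hφ.integral_le_sSup_add_zsmul_of_pos hint hγ t
  rw [zsmul_eq_mul] at h1 h2
  have hfr : |(⌊t / γ⌋ - t / γ) * I| ≤ |I| := by
    rw [abs_mul]
    refine mul_le_of_le_one_left (abs_nonneg _) ?_
    rw [abs_le]
    constructor <;> linarith [Int.floor_le (t / γ), Int.lt_floor_add_one (t / γ)]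
  have hmain : |(∫ s in 0..t, φ s) - t / γ * I| ≤ K := by
    have ha := neg_abs_le a
    have hb := le_abs_self b
    have ha' := abs_nonneg a
    have hb' := abs_nonneg b
    rw [abs_le] at hfr ⊢
    constructor <;> nlinarith [hfr.1, hfr.2]
  have e : t⁻¹ * (∫ s in 0..t, φ s) - γ⁻¹ * I = ((∫ s in 0..t, φ s) - t / γ * I) * t⁻¹ := by
    field_simp
  rw [Real.dist_eq, e, abs_mul, abs_of_pos (inv_pos.2 ht)]
  gcongr

lemma tendsto_average_of_close {ψ : ℝ≥0 → ℝ → ℝ} {φ : ℝ → ℝ} {γ C : ℝ} (hγ : 0 < γ)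
    (hφ : Function.Periodic φ γ) (hint : IntervalIntegrable φ volume 0 γ)
    (hψ : ∀ t : ℝ≥0, IntervalIntegrable (ψ t) volume 0 t) (hψC : ∀ t s, |ψ t s| ≤ C)
    (hφC : ∀ s, |φ s| ≤ C)
    (hclose : ∀ ε : ℝ, 0 < ε → ∃ N : ℝ, 0 ≤ N ∧ ∀ (t : ℝ≥0) (s : ℝ), N ≤ s → s + N ≤ t →
      |ψ t s - φ s| ≤ ε) :
    Tendsto (fun t : ℝ≥0 => (t : ℝ)⁻¹ * ∫ s in 0..(t : ℝ), ψ t s) atTop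
      (𝓝 (γ⁻¹ * ∫ s in 0..γ, φ s)) := by
  have hC0 : 0 ≤ C := (abs_nonneg _).trans (hφC 0)
  have hint' := hφ.intervalIntegrable₀ hγ.ne' hint
  have h1 := (tendsto_average_of_periodic hγ hφ hint).comp
    (NNReal.tendsto_coe_atTop.2 tendsto_id)
  have h2 : Tendsto (fun t : ℝ≥0 => (t : ℝ)⁻¹ * ∫ s in 0..(t : ℝ), (ψ t s - φ s)) atTop (𝓝 0) := by
    rw [Metric.tendsto_atTop]
    intro ε hε
    obtain ⟨N, hN0, hN⟩ := hclose (ε / 2) (half_pos hε)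
    -- The two ends of length `N` contribute at most `4 * C * N`, which is below `ε / 2 * t` once `t
    -- > 8 * C * N / ε`; `2 * N` leaves room for the middle interval.
    set R : ℝ := 2 * N + 8 * C * N / ε + 1 with hR
    have hR0 : 0 < R := by positivity
    refine ⟨R.toNNReal, fun t ht => ?_⟩
    have htR : R ≤ t := Real.toNNReal_le_iff_le_coe.1 ht
    have ht0 : (0 : ℝ) < t := hR0.trans_le htR
    have hN8 : 0 ≤ 8 * C * N / ε := by positivity
    have htN : 2 * N ≤ t := by linarith
    have hd : ∀ a b : ℝ, 0 ≤ a → a ≤ b → b ≤ t →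
        IntervalIntegrable (fun s => ψ t s - φ s) volume a b := fun a b ha hab hb =>
      ((hψ t).mono_set (by
        rw [Set.uIcc_of_le hab, Set.uIcc_of_le ht0.le]; exact Set.Icc_subset_Icc ha hb)).sub
        (hint' a b)
    have hbd : ∀ s, ‖ψ t s - φ s‖ ≤ 2 * C := fun s => by
      rw [Real.norm_eq_abs]
      calc _ ≤ |ψ t s| + |φ s| := abs_sub _ _
        _ ≤ C + C := add_le_add (hψC t s) (hφC s)
        _ = _ := by ring
    have e1 := intervalIntegral.norm_integral_le_of_norm_le_const (a := 0) (b := N)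
      (f := fun s => ψ t s - φ s) fun s _ => hbd s
    have e2 := intervalIntegral.norm_integral_le_of_norm_le_const (a := N) (b := t - N)
      (f := fun s => ψ t s - φ s) (C := ε / 2) fun s hs => by
        rw [Set.uIoc_of_le (by linarith)] at hs
        exact hN t s hs.1.le (by linarith [hs.2])
    have e3 := intervalIntegral.norm_integral_le_of_norm_le_const (a := t - N) (b := t)
      (f := fun s => ψ t s - φ s) fun s _ => hbd s
    rw [sub_zero, abs_of_nonneg hN0] at e1
    rw [abs_of_nonneg (by linarith)] at e2
    rw [sub_sub_cancel, abs_of_nonneg hN0] at e3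
    have hsplit : ∫ s in 0..(t : ℝ), (ψ t s - φ s) = (∫ s in 0..N, (ψ t s - φ s)) +
        (∫ s in N..(t - N), (ψ t s - φ s)) + ∫ s in (t - N)..(t : ℝ), (ψ t s - φ s) := by
      rw [intervalIntegral.integral_add_adjacent_intervals,
        intervalIntegral.integral_add_adjacent_intervals]
      all_goals apply hd <;> linarith
    have hnorm : ‖∫ s in 0..(t : ℝ), (ψ t s - φ s)‖ ≤ 4 * C * N + ε / 2 * t := by
      rw [hsplit]
      have := norm_add₃_le (a := ∫ s in 0..N, (ψ t s - φ s))
        (b := ∫ s in N..(t - N), (ψ t s - φ s)) (c := ∫ s in (t - N)..(t : ℝ), (ψ t s - φ s))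
      nlinarith
    rw [dist_zero_right, norm_mul, Real.norm_eq_abs, abs_of_pos (inv_pos.2 ht0),
      inv_mul_lt_iff₀ ht0]
    refine hnorm.trans_lt ?_
    have : 8 * C * N / ε < t := by linarith
    rw [div_lt_iff₀ hε] at this
    linarith
  have h3 := h1.add h2
  rw [add_zero] at h3
  refine h3.congr fun t => ?_
  simp only [Function.comp_apply, id_eq]
  rw [← mul_add, ← intervalIntegral.integral_add (hint' _ _) ((hψ t).sub (hint' _ _))]
  simp

lemma timeAverage_congr {E : Type*} [MeasurableSpace E] {t : ℝ≥0} {m m' : ℝ≥0 → Measure E}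
    (h : ∀ s ≤ t, m s = m' s) : timeAverage t m = timeAverage t m' := by
  unfold timeAverage
  congr 1
  refine Measure.bind_congr_right ?_
  filter_upwards [ae_restrict_mem measurableSet_Ioc] with s hs
  exact h _ (Real.toNNReal_le_iff_le_coe.2 hs.2)

namespace MarkovProcess

variable {E Ω : Type*} [MeasurableSpace E] [MeasurableSpace Ω] (M : MarkovProcess E Ω)

lemma measurable_uncurry_toNNReal :
    Measurable fun q : ℝ × Ω => M.X q.1.toNNReal q.2 :=
  M.measurable_X.comp ((measurable_real_toNNReal.comp measurable_fst).prodMk measurable_snd)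

lemma intervalIntegrable_integral_coord (μ : Measure Ω) [IsProbabilityMeasure μ] {f : E → ℝ}
    (hf : Measurable f) {C : ℝ} (hC : ∀ y, |f y| ≤ C) (a b : ℝ) :
    IntervalIntegrable (fun s : ℝ => ∫ y, f y ∂(μ.map (M.X s.toNNReal))) volume a b := by
  have e : (fun s : ℝ => ∫ y, f y ∂(μ.map (M.X s.toNNReal))) =
      fun s => ∫ ω, f (M.X s.toNNReal ω) ∂μ := funext fun s =>
    integral_map (M.measurable_coord _).aemeasurable hf.aestronglyMeasurable
  have hm : StronglyMeasurable fun s : ℝ => ∫ ω, f (M.X s.toNNReal ω) ∂μ :=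
    (hf.comp M.measurable_uncurry_toNNReal).stronglyMeasurable.integral_prod_right'
  have : IsFiniteMeasure (volume.restrict (Set.uIoc a b)) := by
    rw [Set.uIoc]; infer_instance
  rw [e, intervalIntegrable_iff]
  refine Integrable.of_bound hm.aestronglyMeasurable C (ae_of_all _ fun s => ?_)
  have := norm_integral_le_of_norm_le_const (μ := μ) (f := fun ω => f (M.X s.toNNReal ω)) (C := C)
    (ae_of_all _ fun ω => hC _)
  simpa using this

lemma integral_timeAverage_coord (μ : Measure Ω) [IsProbabilityMeasure μ] {f : E → ℝ}
    (hf : Measurable f) {C : ℝ} (hC : ∀ y, |f y| ≤ C) (t : ℝ≥0) :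
    ∫ y, f y ∂(timeAverage t fun s => μ.map (M.X s)) =
      (t : ℝ)⁻¹ * ∫ s in 0..(t : ℝ), ∫ y, f y ∂(μ.map (M.X s.toNNReal)) := by
  have hm : Measurable fun s : ℝ => μ.map (M.X s.toNNReal) := by
    refine Measure.measurable_of_measurable_coe _ fun B hB => ?_
    have := measurable_measure_prodMk_left (ν := μ) (M.measurable_uncurry_toNNReal hB)
    exact (funext fun s : ℝ => Measure.map_apply (M.measurable_coord s.toNNReal) hB) ▸ this
  -- Joint measurability of `X` makes the time marginals a kernel, so the average is a composition
  -- and Fubini applies.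
  let ρ : Kernel ℝ E := ⟨fun s => μ.map (M.X s.toNNReal), hm⟩
  have : IsMarkovKernel ρ := ⟨fun s =>
    Measure.isProbabilityMeasure_map (M.measurable_coord _).aemeasurable⟩
  have e : timeAverage t (fun s => μ.map (M.X s)) =
      (t : ℝ≥0∞)⁻¹ • (ρ ∘ₘ volume.restrict (Set.Ioc 0 (t : ℝ))) := rfl
  have hi : Integrable f (ρ ∘ₘ volume.restrict (Set.Ioc 0 (t : ℝ))) :=
    Integrable.of_bound hf.aestronglyMeasurable C (ae_of_all _ hC)
  rw [e, integral_smul_measure, Measure.comp_eq_comp_const_apply]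
  rw [Measure.comp_eq_comp_const_apply] at hi
  rw [Kernel.integral_comp hi, intervalIntegral.integral_of_le t.coe_nonneg]
  simp [ρ]

end MarkovProcess
-- Convergence of the averaged conditional laws
namespace MarkovProcess

variable {E Ω : Type*} [MeasurableSpace E] [MeasurableSpace Ω] {M : MarkovProcess E Ω}
  {A : ℝ≥0 → Set E} {κ : ℝ≥0 → ℝ≥0 → Kernel E Ω}

namespace IsConditionedFamily

/-- Two comparisons: `t - u` large replaces conditioning on survival by `κ`, and `u` large replaces
the starting point `x` by `β`. Each costs `2 * C * δ`. -/
lemma exists_integral_cond_close (h : M.IsConditionedFamily A κ) {t₀ : ℝ≥0} {ν : ℝ≥0 → Measure E}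
    {c₁ c₂ : ℝ≥0∞} (hM : M.Minorization A t₀ ν c₁ c₂) {β : Measure E} [IsProbabilityMeasure β]
    (hβ : β (A 0) = 0) {f : E → ℝ} (hf : Measurable f) {C : ℝ} (hC : ∀ y, |f y| ≤ C) {ε : ℝ}
    (hε : 0 < ε) : ∃ N : ℝ≥0, ∀ t u : ℝ≥0, N ≤ u → u + N ≤ t → ∀ x ∉ A 0,
      |∫ y, f y ∂(((M.P x)[|M.survival A 0 t]).map (M.X u)) -
        ∫ y, f y ∂(β.bind (M.transition κ 0 u))| ≤ ε := by
  have := h.isMarkovKernel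
  have hC0 : 0 ≤ C := by
    obtain ⟨y⟩ := nonempty_of_isProbabilityMeasure β
    exact (abs_nonneg _).trans (hC y)
  set δ : ℝ := ε / (4 * (C + 1)) with hδ
  have hδ0 : 0 < δ := by positivity
  have hδ' : 0 < ENNReal.ofReal δ := ENNReal.ofReal_pos.2 hδ0
  obtain ⟨U, hU⟩ := h.exists_hasCommonMinorant hδ' E
  obtain ⟨T, hT⟩ := h.exists_transition_minorant hM hδ'
  refine ⟨max U T, fun t u hu hut x hx => ?_⟩
  obtain ⟨V, rfl⟩ := exists_add_of_le hut
  have h1 := hU (max U T + V) ((le_max_left _ _).trans le_self_add) 0 u x hx (M.X u) (M.adapted u)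
  rw [← add_assoc, ← transition_apply] at h1
  have h2 : HasCommonMinorant (ENNReal.ofReal δ) (M.transition κ 0 u x)
      (β.bind (M.transition κ 0 u)) := by
    obtain ⟨m, hm1, hm⟩ := hT 0 u ((le_max_right _ _).trans hu)
    exact ⟨m, hm x hx, le_bind_of_ae_le ((measure_eq_zero_iff_ae_notMem.1 hβ).mono hm), hm1⟩
  have := isProbabilityMeasure_cond_survival h.boundary 0 (u + max U T + V) hx
  have := Measure.isProbabilityMeasure_map (μ := (M.P x)[|M.survival A 0 (u + max U T + V)])
    (M.measurable_coord u).aemeasurable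
  have : IsProbabilityMeasure (β.bind (M.transition κ 0 u)) :=
    ⟨by rw [bind_apply_univ, measure_univ]⟩
  have k1 := h1.abs_integral_sub_le ENNReal.ofReal_ne_top hf hC
  have k2 := h2.abs_integral_sub_le ENNReal.ofReal_ne_top hf hC
  rw [ENNReal.toReal_ofReal hδ0.le] at k1 k2
  have k3 : 4 * C * δ ≤ ε := by
    rw [hδ, mul_div_assoc', div_le_iff₀ (by positivity)]
    nlinarith
  refine (abs_sub_le _ _ _).trans ((add_le_add k1 k2).trans ?_)
  linarith

/-- All marginals up to time `a` come from one measure on `Ω`, which gives their measurability in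
`u`. -/
lemma bind_transition_eq_map (h : M.IsConditionedFamily A κ) {β : Measure E} (hβ : β (A 0) = 0)
    {u a : ℝ≥0} (hua : u ≤ a) :
    β.bind (M.transition κ 0 u) = (β.bind (κ 0 a)).map (M.X u) := by
  have hX := M.measurable_coord u
  ext B hB
  rw [Measure.map_apply hX hB, Measure.bind_apply (hX hB) (Kernel.measurable _).aemeasurable,
    Measure.bind_apply hB (Kernel.measurable _).aemeasurable]
  refine lintegral_congr_ae ?_
  filter_upwards [measure_eq_zero_iff_ae_notMem.1 hβ] with x hx
  rw [transition_apply, h.map_eq_map rfl hx hx (M.adapted u) (M.measurable_filtration_coord hua),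
    Measure.map_apply hX hB]

end IsConditionedFamily

end MarkovProcess

theorem mainTheorem2 {E Ω : Type*} [MetricSpace E] [MeasurableSpace E] [BorelSpace E]
    [MeasurableSpace Ω] (M : MarkovProcess E Ω) (A : ℝ≥0 → Set E)
    (hA : M.IsAbsorbingBoundary A)
    (γ : ℝ≥0) (hγ : 0 < γ) (hper : ∀ t, A (t + γ) = A t)
    (n₀ : ℕ) (hCV : M.ConditionCV A (n₀ * γ)) :
    (∃ Q, M.IsQProcessFamily A Q) ∧
    ∀ Q, M.IsQProcessFamily A Q →
      ∃ β : Measure E, IsInvariantSkeleton (A 0) Q γ β ∧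
        (∀ β', IsInvariantSkeleton (A 0) Q γ β' → β' = β) ∧
        ∀ x ∉ A 0, WeaklyTendsto atTop
          (fun t : ℝ≥0 => timeAverage t
            (fun s => ((M.P x)[|M.survival A 0 t]).map (M.X s)))
          (timeAverage γ (fun s => (β.bind (Q 0)).map (fun w => w s))) := by
  obtain ⟨ν, c₁, c₂, hM⟩ := hCV.exists_minorization hA
  obtain ⟨κ, hκ⟩ := hM.exists_isConditionedFamily
  have := hκ.isMarkovKernel
  refine ⟨⟨_, hκ.isQProcessFamily_pathLaw⟩, fun Q hQ => ?_⟩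
  have hper' : ∀ (n : ℕ) t, A (t + n * γ) = A t := fun n => Function.Periodic.nat_mul hper n
  obtain ⟨x₀, hx₀⟩ : ∃ x₀, x₀ ∉ A 0 := by
    have := hM.isProbabilityMeasure 0
    exact (hM.ae_notMem 0).exists
  set L : ℕ → Kernel E E := fun n => M.transition κ 0 (n * γ) with hL
  have hLS : ∀ n, ∀ x ∉ A 0, L n x (A 0) = 0 := fun n x hx => by
    have := hκ.transition_ae_notMem (n * γ) hx
    rwa [hper', ← measure_eq_zero_iff_ae_notMem] at this
  have hLadd : ∀ k n, ∀ x ∉ A 0, L (k + n) x = (L k x).bind (L n) := fun k n x hx => by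
    have := hκ.transition_add_of_periodic (s := 0) (u := k * γ) (n * γ)
      (fun t => by rw [zero_add, add_zero, hper']) hx
    rw [← this, ← add_mul, ← Nat.cast_add]
  have hLmin : ∀ ε : ℝ≥0∞, 0 < ε → ∃ N, ∀ n ≥ N, ∃ m : Measure E, 1 ≤ m Set.univ + ε ∧
      ∀ x ∉ A 0, m ≤ L n x := fun ε hε => by
    obtain ⟨T, hT⟩ := hκ.exists_transition_minorant hM hε
    obtain ⟨N, hN⟩ := exists_nat_ge (T / γ)
    refine ⟨N, fun n hn => hT 0 (n * γ) ?_⟩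
    rw [div_le_iff₀ hγ] at hN
    exact hN.trans (by gcongr)
  obtain ⟨β, hβ, hβ0, hβL⟩ :=
    exists_invariant_of_minorant hx₀ hLS (hA.measurableSet 0) hLadd hLmin
  refine ⟨β, ⟨hβ, hβ0, fun n => ?_⟩, fun β' ⟨hβ', hβ0', hβL'⟩ => ?_, fun x hx f hf => ?_⟩
  · rw [hκ.bind_map_eval hQ hβ0]
    exact hβL n
  · refine invariant_unique_of_minorant hLmin hβ0' hβ0 (fun n => ?_) hβL
    exact (hβL' n).trans (hκ.bind_map_eval hQ hβ0' _)
  have hC : ∀ y, |f y| ≤ ‖f‖ := fun y => f.norm_coe_le_norm y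
  set Φ : ℝ≥0 → ℝ := fun u => ∫ y, f y ∂(β.bind (M.transition κ 0 u)) with hΦ
  -- A step of length `γ` taken first leaves `β` unchanged, and by periodicity of `A` the remaining
  -- step `u` again starts from time `0`.
  have hΦper : Function.Periodic Φ γ := fun u => by
    have e : β.bind (M.transition κ 0 (u + γ)) = β.bind (M.transition κ 0 u) := by
      have e1 : β.bind (M.transition κ 0 (u + γ)) =
          β.bind fun x => (M.transition κ 0 γ x).bind (M.transition κ 0 u) := by
        refine Measure.bind_congr_right ?_
        filter_upwards [measure_eq_zero_iff_ae_notMem.1 hβ0] with y hy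
        rw [add_comm u γ]
        exact hκ.transition_add_of_periodic u (fun t => by rw [zero_add, add_zero, hper]) hy
      rw [e1, ← Measure.bind_bind (Kernel.measurable _).aemeasurable
        (Kernel.measurable _).aemeasurable]
      have := hβL 1
      simp only [hL, Nat.cast_one, one_mul] at this
      rw [← this]
    simp only [hΦ, e]
  -- `Φ ∘ Real.toNNReal` is constant on the negative half-line; reduction modulo `γ` gives an
  -- extension periodic on all of `ℝ`.
  set φ : ℝ → ℝ := fun s => Φ (Int.fract (s / γ) * γ).toNNReal with hφ
  have hγ' : (0 : ℝ) < γ := hγ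
  have hφper : Function.Periodic φ γ := fun s => by
    simp only [hφ]
    rw [add_div, div_self hγ'.ne', Int.fract_add_one]
  have hφΦ : ∀ s : ℝ, 0 ≤ s → φ s = Φ s.toNNReal := fun s hs => by
    have hfl : (0 : ℝ) ≤ Int.fract (s / γ) * γ := mul_nonneg (Int.fract_nonneg _) hγ'.le
    have e : s.toNNReal = (Int.fract (s / γ) * γ).toNNReal + (⌊s / γ⌋₊ : ℕ) * γ := by
      rw [← NNReal.coe_inj]
      push_cast
      rw [Real.coe_toNNReal _ hs, Real.coe_toNNReal _ hfl, ← add_mul,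
        natCast_floor_eq_intCast_floor (div_nonneg hs hγ'.le), Int.fract_add_floor,
        div_mul_cancel₀ _ hγ'.ne']
    rw [e, hΦper.nat_mul]
  have hbprob : ∀ u, IsProbabilityMeasure (β.bind (M.transition κ 0 u)) := fun u =>
    ⟨by rw [bind_apply_univ, measure_univ]⟩
  have hΦC : ∀ u, |Φ u| ≤ ‖f‖ := fun u => by
    have := norm_integral_le_of_norm_le_const (μ := β.bind (M.transition κ 0 u)) (f := f)
      (ae_of_all _ hC)
    simpa using this
  have hκprob : IsProbabilityMeasure (β.bind (κ 0 γ)) := ⟨by rw [bind_apply_univ, measure_univ]⟩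
  have hφeq : ∀ s ∈ Set.Icc (0 : ℝ) γ,
      φ s = ∫ y, f y ∂((β.bind (κ 0 γ)).map (M.X s.toNNReal)) := fun s hs => by
    rw [hφΦ s hs.1]
    simp only [hΦ]
    rw [hκ.bind_transition_eq_map hβ0 (Real.toNNReal_le_iff_le_coe.2 hs.2)]
  have hφint : IntervalIntegrable φ volume 0 γ := by
    refine (M.intervalIntegrable_integral_coord (β.bind (κ 0 γ)) hf hC 0 γ).congr fun s hs => ?_
    rw [Set.uIoc_of_le hγ'.le] at hs
    exact (hφeq s ⟨hs.1.le, hs.2⟩).symm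
  have hcond : ∀ t, IsProbabilityMeasure ((M.P x)[|M.survival A 0 t]) := fun t =>
    M.isProbabilityMeasure_cond_survival hA 0 t hx
  have hlim : ∫ y, f y ∂(timeAverage γ fun s => (β.bind (Q 0)).map fun w => w s) =
      (γ : ℝ)⁻¹ * ∫ s in 0..(γ : ℝ), φ s := by
    rw [timeAverage_congr (m' := fun s => (β.bind (κ 0 γ)).map (M.X s)) fun s hs => by
        rw [hκ.bind_map_eval hQ hβ0, hκ.bind_transition_eq_map hβ0 hs],
      M.integral_timeAverage_coord _ hf hC]
    congr 1
    refine intervalIntegral.integral_congr fun s hs => ?_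
    rw [Set.uIcc_of_le hγ'.le] at hs
    exact (hφeq s hs).symm
  rw [hlim]
  have hfun : (fun t : ℝ≥0 => ∫ y, f y ∂(timeAverage t
      fun s => ((M.P x)[|M.survival A 0 t]).map (M.X s))) = fun t : ℝ≥0 => (t : ℝ)⁻¹ *
        ∫ s in 0..(t : ℝ), ∫ y, f y ∂(((M.P x)[|M.survival A 0 t]).map (M.X s.toNNReal)) :=
    funext fun t => M.integral_timeAverage_coord _ hf hC t
  rw [hfun]
  refine tendsto_average_of_close (C := ‖f‖) hγ' hφper hφint
    (fun t => M.intervalIntegrable_integral_coord _ hf hC _ _) (fun t s => ?_)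
    (fun s => hΦC _) fun ε hε => ?_
  · have := Measure.isProbabilityMeasure_map (μ := (M.P x)[|M.survival A 0 t])
      (M.measurable_coord s.toNNReal).aemeasurable
    have := norm_integral_le_of_norm_le_const
      (μ := ((M.P x)[|M.survival A 0 t]).map (M.X s.toNNReal)) (f := f) (ae_of_all _ hC)
    simpa using this
  · obtain ⟨N, hN⟩ := hκ.exists_integral_cond_close hM hβ0 hf hC hε
    refine ⟨N, N.2, fun t s hs hst => ?_⟩
    have hs0 : 0 ≤ s := N.2.trans hs
    rw [hφΦ s hs0]
    refine hN t s.toNNReal (NNReal.le_toNNReal_of_coe_le hs) ?_ x hx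
    rw [← NNReal.coe_le_coe, NNReal.coe_add, Real.coe_toNNReal _ hs0]
    exact hst
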